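/- All Lie groups are real, finite-dimensional and smooth, all maps and cochains are smooth. Identify a Lie 2-group $\mathcal G$ with its crossed module of Lie groups: a homomorphism $i:G\to H$ and a right action $(g,h)\mapsto g^h$ of $H$ on $G$ by automorphisms such that $i(g^h)=h^{-1}i(g)h$ and $g_1^{i(g_2)}=g_2^{-1}g_1g_2$. Its group of arrows is $G\rtimes H$, where the arrow $(g,h)$ has source $h$ and target $h\,i(g)$. Let $\phi:W\to V$ be a linear map of finite-dimensional real vector spaces (a 2-vector space, regarded as a Lie 2-group with trivial action). A 2-representation $\rho$ of $\mathcal G$ on $\phi$ consists of representations $\rho_0^1:H\to GL(W)$, $\rho_0^0:H\to GL(V)$ with $\phi\rho_0^1(h)=\rho_0^0(h)\phi$, and a map $\rho_1:G\to \mathrm{Hom}(V,W)$ with $\rho_1(g_0g_1)=\rho_1(g_0)+\rho_1(g_1)+\rho_1(g_0)\phi\rho_1(g_1)$, $\rho_0^1(i(g))=I+\rho_1(g)\phi$, $\rho_0^0(i(g))=I+\phi\rho_1(g)$ and $\rho_1(g^h)=\rho_0^1(h)^{-1}\rho_1(g)\rho_0^0(h)$. An extension of $\mathcal G$ by $\phi$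 is a Lie 2-group $\epsilon:E_1\to E_0$ with maps of Lie 2-groups $j=(j_1,j_0)$ from $W\to V$ and $\pi=(\pi_1,\pi_0)$ to $G\to H$ such that $1\to W\to E_1\to G\to 1$ and $1\to V\to E_0\to H\to 1$ are short exact sequences of Lie groups. It is split if $\pi_1,\pi_0$ have smooth sections $\sigma_1,\sigma_0$ (not necessarily homomorphisms). Two extensions are equivalent if there is an isomorphism of Lie 2-groups between them compatible with $j$ and $\pi$. A split extension with splitting $\sigma$ induces the 2-representation $\rho_0^0(h)v=\sigma_0(h)v\sigma_0(h)^{-1}$, $\rho_0^1(h)w=w^{\sigma_0(h)^{-1}}$, $\rho_1(g)v=\sigma_1(g)^v\sigma_1(g)^{-1}$. Given $\rho$, let $C^1\xrightarrow{\nabla}C^2\xrightarrow{\nabla}C^3$ be the following piece of the complex of Lie 2-group cochains with values in $\rho$, where cochains are normalised (they vanish when an argument in $H$, in $G$ or in the group $G\rtimes H$ is the identity). $C^1$ consists of the triples $(\lambda_0,\lambda_1,v)\in C(H,V)\oplus C(G,W)\oplus V$. $C^2$ consists of the 6-tuples $(\omega_0,\alpha,\varphi,\omega_1,\lambda,v)\in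 C(H^2,V)\oplus C(H\times G,W)\oplus C(G\rtimes H,V)\oplus C(G^2,W)\oplus C(G,W)\oplus V$. The differential of $(\lambda_0,\lambda_1,v)$ is the 6-tuple with components $$\begin{aligned} (h_0,h_1)&\mapsto\rho_0^0(h_0)\lambda_0(h_1)-\lambda_0(h_0h_1)+\lambda_0(h_0),\\ (h;f)&\mapsto\rho_0^1(h)^{-1}\rho_1(f)\lambda_0(h)-\lambda_1(f^h)+\rho_0^1(h)^{-1}\lambda_1(f),\\ (g,h)&\mapsto\lambda_0(h)-\lambda_0(hi(g))+\rho_0^0(hi(g))v-v+\rho_0^0(h)\phi\lambda_1(g),\\ (g_0,g_1)&\mapsto\rho_0^1(i(g_0))\lambda_1(g_1)-\lambda_1(g_0g_1)+\lambda_1(g_0),\\ g&\mapsto-\rho_1(g)v,\qquad\text{and}\quad -v. \end{aligned}$$ A 6-tuple is a cocycle ($\nabla=0$) iff the following expressions vanish identically: $$\begin{aligned} &\rho_0^0(h_0)\omega_0(h_1,h_2)-\omega_0(h_0h_1,h_2)+\omega_0(h_0,h_1h_2)-\omega_0(h_0,h_1),\\ &-\omega_0(h_0,h_1)+\omega_0(h_0i(g_0),h_1i(g_1))+\rho_0^0(h_0i(g_0))\varphi(g_1,h_1)-\varphi(g_0^{h_1}g_1,h_0h_1)+\varphi(g_0,h_0)\\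 &\qquad-\rho_0^0(h_0h_1)\phi\big(\alpha(h_1;g_0)+\omega_1(g_0^{h_1},g_1)\big),\\ &\rho_0^1(h_0h_1)^{-1}\rho_1(f)\omega_0(h_0,h_1)-\alpha(h_1;f^{h_0})+\alpha(h_0h_1;f)-\rho_0^1(h_1)^{-1}\alpha(h_0;f),\\ &\varphi(g_1,h)-\varphi(g_1g_0,h)+\varphi(g_0,hi(g_1))+\rho_0^0(hi(g_1g_0))v-v-\rho_0^0(hi(g_1))\phi\lambda(g_0)-\rho_0^0(h)\phi\omega_1(g_1,g_0),\\ &-\rho_0^1(hi(g))^{-1}\rho_1(f)\varphi(g,h)+\rho_0^1(i(g))^{-1}\alpha(h;f)-\alpha(hi(g);f)-\lambda(f^{hi(g)})+\rho_0^1(hi(g))^{-1}\lambda(f)\\ &\qquad+\rho_0^1(i(g))^{-1}\omega_1(f^h,g)+\omega_1(g^{-1},f^hg)-\omega_1(g^{-1},g),\\ &\rho_0^1(i(f_0^h))\alpha(h;f_1)-\alpha(h;f_0f_1)+\alpha(h;f_0)+\omega_1(f_0^h,f_1^h)-\rho_0^1(h)^{-1}\omega_1(f_0,f_1),\\ &\rho_1(g)v-\lambda(g),\qquad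 \rho_0^1(i(g_0))\lambda(g_1)-\lambda(g_0g_1)+\lambda(g_0),\\ &\rho_0^1(i(g_0))\omega_1(g_1,g_2)-\omega_1(g_0g_1,g_2)+\omega_1(g_0,g_1g_2)-\omega_1(g_0,g_1). \end{aligned}$$ One has $\nabla^2=0$, and $H^2_\nabla(\mathcal G,\phi)=\ker(\nabla|_{C^2})/\nabla(C^1)$. A 4-tuple $(\omega_0,\omega_1,\alpha,\varphi)\in C(H^2,V)\oplus C(G^2,W)\oplus C(H\times G,W)\oplus C(G,V)$ (not required to be normalised) defines an extension if $H\times V$ and $G\times W$ with the products $$(h_0,v_0)(h_1,v_1)=(h_0h_1,v_0+\rho_0^0(h_0)v_1+\omega_0(h_0,h_1)),\quad (g_0,w_0)(g_1,w_1)=(g_0g_1,w_0+\rho_0^1(i(g_0))w_1+\omega_1(g_0,g_1)),$$ the map $\epsilon(g,w)=(i(g),\phi(w)+\varphi(g))$, the action $(g,w)^{(h,v)}=(g^h,\rho_0^1(h)^{-1}(w+\rho_1(g)v)+\alpha(h;g))$ and the obvious inclusions ($v\mapsto(1,v)$, $w\mapsto(1,w)$) and projections form an extension of $\mathcal G$ by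 $\phi$. Attach to it the 6-tuple $(\omega_0,\alpha,\hat\varphi,\omega_1,0,0)$ with $\hat\varphi(g,h)=\omega_0(h,i(g))+\rho_0^0(h)\varphi(g)$. **Theorem.** Every split extension of $\mathcal G$ by $\phi$ induces exactly one 2-representation, independent of the splitting; an extension equivalent to a split one is split and induces the same 2-representation. Moreover, for every 2-representation $\rho$ of $\mathcal G$ on $\phi$: 1. a 4-tuple defines an extension if and only if the attached 6-tuple is a 2-cocycle, and an extension is, up to equivalence, defined by a 4-tuple if and only if it is split and induces $\rho$; 2. every 2-cocycle with $v=0$ is attached to exactly one 4-tuple, and every 2-cocycle is cohomologous to one with $v=0$; 3. two 4-tuples that define extensions define equivalent ones if and only if the attached cocycles are cohomologous. Consequently, sending the class of the cocycle attached to a 4-tuple to the class of the extension which the 4-tuple defines is a bijection from $H^2_\nabla(\mathcal G,\phi)$ onto the set of equivalence classes of split extensions of $\mathcal G$ by $\phi$ that induce $\rho$. -/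

import Mathlib

open scoped Manifold ContDiff

universe u

/-! ### Lie 2-groups, as crossed modules of Lie groups -/

/-- A (finite-dimensional, real) Lie 2-group, presented by its crossed module `i : G → H` of Lie
groups, where `act g h` is the right action `g ^ h` of `H` on `G` by automorphisms. The Lie groups
`G` and `H` are modelled on the finite-dimensional normed spaces `𝔤` and `𝔥`. The group of arrows
of the 2-group is `G ⋊ H`; the arrow `(g, h)` has source `h` and target `h * i g`, the group
multiplication is `(g₀, h₀) (g₁, h₁) = (g₀ ^ h₁ * g₁, h₀ * h₁)`. -/
structure LieTwoGroup : Type (u + 1) where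
  G : Type u
  H : Type u
  𝔤 : Type u
  𝔥 : Type u
  [normedAddCommGroup𝔤 : NormedAddCommGroup 𝔤]
  [normedSpace𝔤 : NormedSpace ℝ 𝔤]
  [finiteDimensional𝔤 : FiniteDimensional ℝ 𝔤]
  [normedAddCommGroup𝔥 : NormedAddCommGroup 𝔥]
  [normedSpace𝔥 : NormedSpace ℝ 𝔥]
  [finiteDimensional𝔥 : FiniteDimensional ℝ 𝔥]
  [groupG : Group G]
  [topologicalSpaceG : TopologicalSpace G]
  [chartedSpaceG : ChartedSpace 𝔤 G]
  [lieGroupG : LieGroup 𝓘(ℝ, 𝔤) ∞ G]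
  [groupH : Group H]
  [topologicalSpaceH : TopologicalSpace H]
  [chartedSpaceH : ChartedSpace 𝔥 H]
  [lieGroupH : LieGroup 𝓘(ℝ, 𝔥) ∞ H]
  i : G →* H
  act : G → H → G
  act_one : ∀ g, act g 1 = g
  act_mul : ∀ g h₀ h₁, act g (h₀ * h₁) = act (act g h₀) h₁
  mul_act : ∀ g₀ g₁ h, act (g₀ * g₁) h = act g₀ h * act g₁ h
  i_act : ∀ g h, i (act g h) = h⁻¹ * i g * h
  peiffer : ∀ g₀ g₁, act g₀ (i g₁) = g₁⁻¹ * g₀ * g₁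
  contMDiff_i : ContMDiff 𝓘(ℝ, 𝔤) 𝓘(ℝ, 𝔥) ∞ i
  contMDiff_act : ContMDiff (𝓘(ℝ, 𝔤).prod 𝓘(ℝ, 𝔥)) 𝓘(ℝ, 𝔤) ∞ (fun p : G × H => act p.1 p.2)

namespace LieTwoGroup

attribute [instance] normedAddCommGroup𝔤 normedSpace𝔤 finiteDimensional𝔤
attribute [instance] normedAddCommGroup𝔥 normedSpace𝔥 finiteDimensional𝔥
attribute [instance] groupG topologicalSpaceG chartedSpaceG lieGroupG
attribute [instance] groupH topologicalSpaceH chartedSpaceH lieGroupH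

theorem one_act (X : LieTwoGroup.{u}) (h : X.H) : X.act 1 h = 1 := by
  have := X.mul_act 1 1 h
  simpa using this

end LieTwoGroup

/-! ### 2-representations -/

/-- A representation of the Lie 2-group `X` on the 2-vector space `φ : W → V`, that is, a morphism
of Lie 2-groups from `X` to the general linear Lie 2-group `GL(φ)`, where
* `GL(φ)₀ = {(F, f) ∈ GL(W) × GL(V) | φ ∘ F = f ∘ φ}`,
* `GL(φ)₁ = {A ∈ Hom(V, W) | (I + A φ, I + φ A) ∈ GL(W) × GL(V)}` with the product
  `A ⊙ B = A + B + A φ B`,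
* the structural map is `A ↦ (I + A φ, I + φ A)` and the action is `A ^ (F, f) = F⁻¹ A f`.

The map on objects is `h ↦ (ρW h, ρV h)` and the map on arrows is `ρ₁`. A monoid homomorphism from
a group to the endomorphisms of a vector space takes values in the general linear group, and
`map_i_W`, `map_i_V` then force `ρ₁` to take values in `GL(φ)₁`. -/
@[ext]
structure TwoRep (X : LieTwoGroup.{u}) {W V : Type u}
    [NormedAddCommGroup W] [NormedSpace ℝ W] [NormedAddCommGroup V] [NormedSpace ℝ V]
    (φ : W →L[ℝ] V) where
  ρW : X.H →* (W →L[ℝ] W)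
  ρV : X.H →* (V →L[ℝ] V)
  ρ₁ : X.G → (V →L[ℝ] W)
  comm : ∀ h w, φ (ρW h w) = ρV h (φ w)
  map_mul : ∀ g₀ g₁ v, ρ₁ (g₀ * g₁) v = ρ₁ g₀ v + ρ₁ g₁ v + ρ₁ g₀ (φ (ρ₁ g₁ v))
  map_i_W : ∀ g w, ρW (X.i g) w = w + ρ₁ g (φ w)
  map_i_V : ∀ g v, ρV (X.i g) v = v + φ (ρ₁ g v)
  map_act : ∀ g h v, ρ₁ (X.act g h) v = ρW h⁻¹ (ρ₁ g (ρV h v))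
  contMDiff_ρW : ContMDiff 𝓘(ℝ, X.𝔥) 𝓘(ℝ, W →L[ℝ] W) ∞ ρW
  contMDiff_ρV : ContMDiff 𝓘(ℝ, X.𝔥) 𝓘(ℝ, V →L[ℝ] V) ∞ ρV
  contMDiff_ρ₁ : ContMDiff 𝓘(ℝ, X.𝔤) 𝓘(ℝ, V →L[ℝ] W) ∞ ρ₁

/-! ### The complex of Lie 2-group cochains in total degrees 1, 2 and 3 -/

section Complex

variable (X : LieTwoGroup.{u}) {W V : Type u}
  [NormedAddCommGroup W] [NormedSpace ℝ W] [NormedAddCommGroup V] [NormedSpace ℝ V]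
  {φ : W →L[ℝ] V}

variable (W V) in
/-- Triples `(lam₀, lam₁, v)` of arbitrary functions, in tridegrees `(p,q)_r` equal to
`(0,1)_0`, `(0,0)_1`, `(1,0)_0`. -/
abbrev PreCochain₁ : Type u := (X.H → V) × (X.G → W) × V

variable (W V) in
/-- 6-tuples `(ω₀, α, χ, ω₁, lam, v)` of arbitrary functions, in tridegrees `(p,q)_r` equal to
`(0,2)_0`, `(0,1)_1`, `(1,1)_0`, `(0,0)_2`, `(1,0)_1`, `(2,0)_0`. Here `α h g` stands for
`α(h; g)`, and `χ g h` is the value at the arrow `(g, h)`. -/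
abbrev PreCochain₂ : Type u :=
  (X.H → X.H → V) × (X.H → X.G → W) × (X.G → X.H → V) × (X.G → X.G → W) × (X.G → W) × V

variable (W V) in
/-- 10-tuples of arbitrary functions, in tridegrees `(p,q)_r` equal to `(0,3)_0`, `(1,2)_0`,
`(0,2)_1`, `(2,1)_0`, `(1,1)_1`, `(0,1)_2`, `(3,0)_0`, `(2,0)_1`, `(1,0)_2`, `(0,0)_3`.
A function on pairs of arrows takes two arguments `(g, h)` in `G × H`; a function on composable
pairs of arrows takes arguments `g₀ g₁ h`, standing for the arrows `(g₀, h * i g₁)` and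
`(g₁, h)`. -/
abbrev PreCochain₃ : Type u :=
  (X.H → X.H → X.H → V) × (X.G × X.H → X.G × X.H → V) × (X.H → X.H → X.G → W) ×
  (X.G → X.G → X.H → V) × (X.G → X.H → X.G → W) × (X.H → X.G → X.G → W) ×
  V × (X.G → W) × (X.G → X.G → W) × (X.G → X.G → X.G → W)

variable (W V) in
/-- The 1-cochains: smooth triples, normalised in the group variables. -/
def cochains₁ : Submodule ℝ (PreCochain₁ X W V) where
  carrier := {c | ContMDiff 𝓘(ℝ, X.𝔥) 𝓘(ℝ, V) ∞ c.1 ∧ ContMDiff 𝓘(ℝ, X.𝔤) 𝓘(ℝ, W) ∞ c.2.1 ∧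
    c.1 1 = 0 ∧ c.2.1 1 = 0}
  zero_mem' := ⟨contMDiff_const, contMDiff_const, rfl, rfl⟩
  add_mem' := by
    rintro a b ⟨h1, h2, h3, h4⟩ ⟨k1, k2, k3, k4⟩
    exact ⟨h1.add k1, h2.add k2, by simp [h3, k3], by simp [h4, k4]⟩
  smul_mem' := by
    rintro r a ⟨h1, h2, h3, h4⟩
    exact ⟨(contMDiff_const (I' := 𝓘(ℝ, ℝ)) (c := r)).smul h1, (contMDiff_const (I' := 𝓘(ℝ, ℝ)) (c := r)).smul h2, by simp [h3], by simp [h4]⟩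

variable (W V) in
/-- The 2-cochains: smooth 6-tuples, normalised in the group variables, i.e. vanishing as soon as
one of the arguments in `H`, in `G` or in the group of arrows is the identity. -/
def cochains₂ : Submodule ℝ (PreCochain₂ X W V) where
  carrier := {c |
    (ContMDiff (𝓘(ℝ, X.𝔥).prod 𝓘(ℝ, X.𝔥)) 𝓘(ℝ, V) ∞ (fun p : X.H × X.H => c.1 p.1 p.2) ∧
      (∀ h, c.1 1 h = 0) ∧ (∀ h, c.1 h 1 = 0)) ∧
    (ContMDiff (𝓘(ℝ, X.𝔥).prod 𝓘(ℝ, X.𝔤)) 𝓘(ℝ, W) ∞ (fun p : X.H × X.G => c.2.1 p.1 p.2) ∧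
      (∀ g, c.2.1 1 g = 0) ∧ (∀ h, c.2.1 h 1 = 0)) ∧
    (ContMDiff (𝓘(ℝ, X.𝔤).prod 𝓘(ℝ, X.𝔥)) 𝓘(ℝ, V) ∞ (fun p : X.G × X.H => c.2.2.1 p.1 p.2) ∧
      c.2.2.1 1 1 = 0) ∧
    (ContMDiff (𝓘(ℝ, X.𝔤).prod 𝓘(ℝ, X.𝔤)) 𝓘(ℝ, W) ∞ (fun p : X.G × X.G => c.2.2.2.1 p.1 p.2) ∧
      (∀ g, c.2.2.2.1 1 g = 0) ∧ (∀ g, c.2.2.2.1 g 1 = 0)) ∧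
    (ContMDiff 𝓘(ℝ, X.𝔤) 𝓘(ℝ, W) ∞ c.2.2.2.2.1 ∧ c.2.2.2.2.1 1 = 0)}
  zero_mem' := by
    refine ⟨⟨contMDiff_const, ?_, ?_⟩, ⟨contMDiff_const, ?_, ?_⟩, ⟨contMDiff_const, ?_⟩,
      ⟨contMDiff_const, ?_, ?_⟩, ⟨contMDiff_const, ?_⟩⟩ <;> intros <;> rfl
  add_mem' := by
    rintro a b ⟨⟨a1, a2, a3⟩, ⟨a4, a5, a6⟩, ⟨a7, a8⟩, ⟨a9, a10, a11⟩, ⟨a12, a13⟩⟩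
      ⟨⟨b1, b2, b3⟩, ⟨b4, b5, b6⟩, ⟨b7, b8⟩, ⟨b9, b10, b11⟩, ⟨b12, b13⟩⟩
    refine ⟨⟨a1.add b1, ?_, ?_⟩, ⟨a4.add b4, ?_, ?_⟩, ⟨a7.add b7, ?_⟩,
      ⟨a9.add b9, ?_, ?_⟩, ⟨a12.add b12, ?_⟩⟩ <;> intros <;> simp [*]
  smul_mem' := by
    rintro r a ⟨⟨a1, a2, a3⟩, ⟨a4, a5, a6⟩, ⟨a7, a8⟩, ⟨a9, a10, a11⟩, ⟨a12, a13⟩⟩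
    refine ⟨⟨(contMDiff_const (I' := 𝓘(ℝ, ℝ)) (c := r)).smul a1, ?_, ?_⟩, ⟨(contMDiff_const (I' := 𝓘(ℝ, ℝ)) (c := r)).smul a4, ?_, ?_⟩,
      ⟨(contMDiff_const (I' := 𝓘(ℝ, ℝ)) (c := r)).smul a7, ?_⟩, ⟨(contMDiff_const (I' := 𝓘(ℝ, ℝ)) (c := r)).smul a9, ?_, ?_⟩,
      ⟨(contMDiff_const (I' := 𝓘(ℝ, ℝ)) (c := r)).smul a12, ?_⟩⟩ <;> intros <;> simp [*]

variable {X} (ρ : TwoRep X φ)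

/-- The differential `∇ : C¹ → C²`, with components (`ρV`, `ρW` are `ρ₀⁰`, `ρ₀¹`)
* `(0,2)_0`: `δ lam₀`,
* `(0,1)_1`: `δ₍₁₎ lam₀ - δ lam₁`,
* `(1,1)_0`: `∂ lam₀ + δ v + Δ lam₁`,
* `(0,0)_2`: `δ₍₁₎ lam₁`,
* `(1,0)_1`: `-δ₍₁₎ v` (and `∂ lam₁ = 0`),
* `(2,0)_0`: `-∂ v = -v`. -/
def nabla₁ : PreCochain₁ X W V →ₗ[ℝ] PreCochain₂ X W V where
  toFun := fun (lam₀, lam₁, v) =>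
    (fun h₀ h₁ => ρ.ρV h₀ (lam₀ h₁) - lam₀ (h₀ * h₁) + lam₀ h₀,
     fun h f => ρ.ρW h⁻¹ (ρ.ρ₁ f (lam₀ h)) - (lam₁ (X.act f h) - ρ.ρW h⁻¹ (lam₁ f)),
     fun g h => (lam₀ h - lam₀ (h * X.i g)) + (ρ.ρV (h * X.i g) v - v) + ρ.ρV h (φ (lam₁ g)),
     fun g₀ g₁ => ρ.ρW (X.i g₀) (lam₁ g₁) - lam₁ (g₀ * g₁) + lam₁ g₀,
     fun g => - ρ.ρ₁ g v,
     -v)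
  map_add' := by
    rintro ⟨a1, a2, a3⟩ ⟨b1, b2, b3⟩
    refine Prod.ext ?_ (Prod.ext ?_ (Prod.ext ?_ (Prod.ext ?_ (Prod.ext ?_ ?_)))) <;>
      simp only [Prod.mk_add_mk] <;> (try ext) <;>
      (try simp only [Pi.add_apply, map_add]) <;> abel
  map_smul' := by
    rintro r ⟨a1, a2, a3⟩
    refine Prod.ext ?_ (Prod.ext ?_ (Prod.ext ?_ (Prod.ext ?_ (Prod.ext ?_ ?_)))) <;>
      simp only [Prod.smul_mk] <;> (try ext) <;>
      simp only [Pi.smul_apply, map_smul, RingHom.id_apply, smul_add, smul_sub, smul_neg]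

/-- The differential `∇ : C² → C³`, with components
* `(0,3)_0`: `δ ω₀`,
* `(1,2)_0`: `-∂ ω₀ + δ χ - Δ α - Δ₂ᵖ ω₁`,
* `(0,2)_1`: `δ₍₁₎ ω₀ - δ α`,
* `(2,1)_0`: `∂ χ + δ v - Δ lam - Δ₂^q ω₁`,
* `(1,1)_1`: `-δ₍₁₎ χ + ∂ α - δ lam + Δ ω₁`,
* `(0,1)_2`: `δ₍₁₎ α + δ ω₁`,
* `(3,0)_0`: `-∂ v = 0`,
* `(2,0)_1`: `δ₍₁₎ v - ∂ lam = δ₍₁₎ v - lam`,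
* `(1,0)_2`: `-δ₍₁₎ lam` (and `∂ ω₁ = 0`),
* `(0,0)_3`: `δ₍₁₎ ω₁`. -/
def nabla₂ : PreCochain₂ X W V →ₗ[ℝ] PreCochain₃ X W V where
  toFun := fun (ω₀, α, χ, ω₁, lam, v) =>
    (fun h₀ h₁ h₂ => ρ.ρV h₀ (ω₀ h₁ h₂) - ω₀ (h₀ * h₁) h₂ + ω₀ h₀ (h₁ * h₂) - ω₀ h₀ h₁,
     fun (g₀, h₀) (g₁, h₁) =>
      - (ω₀ h₀ h₁ - ω₀ (h₀ * X.i g₀) (h₁ * X.i g₁))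
      + (ρ.ρV (h₀ * X.i g₀) (χ g₁ h₁) - χ (X.act g₀ h₁ * g₁) (h₀ * h₁) + χ g₀ h₀)
      - ρ.ρV (h₀ * h₁) (φ (α h₁ g₀))
      - ρ.ρV (h₀ * h₁) (φ (ω₁ (X.act g₀ h₁) g₁)),
     fun h₀ h₁ f =>
      ρ.ρW (h₀ * h₁)⁻¹ (ρ.ρ₁ f (ω₀ h₀ h₁))
      - (α h₁ (X.act f h₀) - α (h₀ * h₁) f + ρ.ρW h₁⁻¹ (α h₀ f)),
     fun g₀ g₁ h =>
      (χ g₁ h - χ (g₁ * g₀) h + χ g₀ (h * X.i g₁))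
      + (ρ.ρV (h * X.i (g₁ * g₀)) v - v)
      - ρ.ρV (h * X.i g₁) (φ (lam g₀))
      - ρ.ρV h (φ (ω₁ g₁ g₀)),
     fun g h f =>
      - ρ.ρW (h * X.i g)⁻¹ (ρ.ρ₁ f (χ g h))
      + (ρ.ρW (X.i g)⁻¹ (α h f) - α (h * X.i g) f)
      - (lam (X.act f (h * X.i g)) - ρ.ρW (h * X.i g)⁻¹ (lam f))
      + (ρ.ρW (X.i g)⁻¹ (ω₁ (X.act f h) g) + ω₁ g⁻¹ (X.act f h * g) - ω₁ g⁻¹ g),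
     fun h f₀ f₁ =>
      (ρ.ρW (X.i (X.act f₀ h)) (α h f₁) - α h (f₀ * f₁) + α h f₀)
      + (ω₁ (X.act f₀ h) (X.act f₁ h) - ρ.ρW h⁻¹ (ω₁ f₀ f₁)),
     0,
     fun g => ρ.ρ₁ g v - lam g,
     fun g₀ g₁ => - (ρ.ρW (X.i g₀) (lam g₁) - lam (g₀ * g₁) + lam g₀),
     fun g₀ g₁ g₂ => ρ.ρW (X.i g₀) (ω₁ g₁ g₂) - ω₁ (g₀ * g₁) g₂ + ω₁ g₀ (g₁ * g₂) - ω₁ g₀ g₁)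
  map_add' := by
    rintro ⟨a1, a2, a3, a4, a5, a6⟩ ⟨b1, b2, b3, b4, b5, b6⟩
    refine Prod.ext ?_ (Prod.ext ?_ (Prod.ext ?_ (Prod.ext ?_ (Prod.ext ?_ (Prod.ext ?_
      (Prod.ext ?_ (Prod.ext ?_ (Prod.ext ?_ ?_)))))))) <;>
      simp only [Prod.mk_add_mk] <;> (try ext) <;>
      (try simp only [Pi.add_apply, map_add]) <;> abel
  map_smul' := by
    rintro r ⟨a1, a2, a3, a4, a5, a6⟩
    refine Prod.ext ?_ (Prod.ext ?_ (Prod.ext ?_ (Prod.ext ?_ (Prod.ext ?_ (Prod.ext ?_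
      (Prod.ext ?_ (Prod.ext ?_ (Prod.ext ?_ ?_)))))))) <;>
      simp only [Prod.smul_mk] <;> (try ext) <;>
      simp only [Pi.smul_apply, map_smul, RingHom.id_apply, smul_add, smul_sub, smul_neg,
        smul_zero]

/-- The 2-cocycles. -/
def cocycles₂ : Submodule ℝ (PreCochain₂ X W V) := cochains₂ X W V ⊓ LinearMap.ker (nabla₂ ρ)

/-- The 2-coboundaries. -/
def coboundaries₂ : Submodule ℝ (PreCochain₂ X W V) := (cochains₁ X W V).map (nabla₁ ρ)

/-- The second cohomology `H²_∇(X, φ)`. -/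
abbrev H₂ : Type u := (cocycles₂ ρ) ⧸ (coboundaries₂ ρ).submoduleOf (cocycles₂ ρ)

end Complex

section Square

variable {X : LieTwoGroup.{u}} {W V : Type u}
  [NormedAddCommGroup W] [NormedSpace ℝ W] [NormedAddCommGroup V] [NormedSpace ℝ V]
  {φ : W →L[ℝ] V} (ρ : TwoRep X φ)

theorem TwoRep.ρW_mul (a b : X.H) (w : W) : ρ.ρW (a * b) w = ρ.ρW a (ρ.ρW b w) := by
  simp

theorem TwoRep.ρV_mul (a b : X.H) (v : V) : ρ.ρV (a * b) v = ρ.ρV a (ρ.ρV b v) := by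
  simp

theorem TwoRep.ρW_inv_self (a : X.H) (w : W) : ρ.ρW a⁻¹ (ρ.ρW a w) = w := by
  rw [← ρ.ρW_mul]; simp

theorem TwoRep.ρW_self_inv (a : X.H) (w : W) : ρ.ρW a (ρ.ρW a⁻¹ w) = w := by
  rw [← ρ.ρW_mul]; simp

theorem TwoRep.ρV_self_inv (a : X.H) (w : V) : ρ.ρV a (ρ.ρV a⁻¹ w) = w := by
  rw [← ρ.ρV_mul]; simp

theorem TwoRep.ρ₁_one (v : V) : ρ.ρ₁ 1 v = 0 := by
  have h1 := ρ.map_mul 1 1 v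
  have h2 : φ (ρ.ρ₁ 1 v) = 0 := by
    have := ρ.map_i_V 1 v
    simpa using this
  rw [h2] at h1
  simpa using h1

theorem nabla₂_nabla₁ (c : PreCochain₁ X W V) (hc : c ∈ cochains₁ X W V) :
    nabla₂ ρ (nabla₁ ρ c) = 0 := by
  obtain ⟨a, b, v⟩ := c
  obtain ⟨-, -, ha, hb⟩ := hc
  change a 1 = 0 at ha
  change b 1 = 0 at hb
  refine Prod.ext ?_ (Prod.ext ?_ (Prod.ext ?_ (Prod.ext ?_ (Prod.ext ?_ (Prod.ext ?_
      (Prod.ext ?_ (Prod.ext ?_ (Prod.ext ?_ ?_))))))))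
  · ext h₀ h₁ h₂
    simp only [nabla₁, nabla₂, LinearMap.coe_mk, AddHom.coe_mk]
    simp only [map_add, map_sub, ρ.ρV_mul, mul_assoc, Pi.zero_apply, Prod.fst_zero]
    abel
  · ext ⟨g₀, h₀⟩ ⟨g₁, h₁⟩
    have e1 : h₀ * h₁ * X.i (X.act g₀ h₁ * g₁) = h₀ * (X.i g₀ * (h₁ * X.i g₁)) := by
      rw [map_mul, X.i_act]; group
    simp only [nabla₁, nabla₂, LinearMap.coe_mk, AddHom.coe_mk]
    simp only [e1, Prod.snd_zero, Prod.fst_zero, Pi.zero_apply]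
    simp only [map_add, map_sub, ρ.ρV_mul, ρ.ρW_mul, mul_assoc, ρ.comm,
      X.i_act, ρ.map_i_V, ρ.ρV_self_inv]
    abel
  · ext h₀ h₁ f
    simp only [nabla₁, nabla₂, LinearMap.coe_mk, AddHom.coe_mk]
    simp only [Prod.snd_zero, Prod.fst_zero, Pi.zero_apply]
    simp only [map_add, map_sub, mul_inv_rev, ρ.ρW_mul, ρ.map_act, X.act_mul]
    abel
  · ext g₀ g₁ h
    simp only [nabla₁, nabla₂, LinearMap.coe_mk, AddHom.coe_mk]
    simp only [Prod.snd_zero, Prod.fst_zero, Pi.zero_apply]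
    simp only [map_add, map_sub, map_neg, ρ.ρV_mul, X.i.map_mul, mul_assoc, ρ.map_i_V,
      ρ.map_i_W]
    abel
  · ext g h f
    have e1 : g⁻¹ * (X.act f h * g) = X.act f (h * X.i g) := by
      rw [X.act_mul, X.peiffer]; group
    have e2 : X.act f h * g = g * X.act f (h * X.i g) := by rw [← e1]; group
    simp only [nabla₁, nabla₂, LinearMap.coe_mk, AddHom.coe_mk]
    simp only [Prod.snd_zero, Prod.fst_zero, Pi.zero_apply]
    simp only [e1, inv_mul_cancel, hb, map_inv]
    have e4 : ρ.ρ₁ f (ρ.ρV (h * X.i g) v) =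
      ρ.ρW (h * X.i g) (ρ.ρ₁ (X.act f (h * X.i g)) v) := by
      rw [ρ.map_act, ρ.ρW_self_inv]
    have e3 (w : W) : ρ.ρW h⁻¹ (ρ.ρ₁ f (ρ.ρV h (φ w))) = ρ.ρW (X.i (X.act f h)) w - w := by
      rw [ρ.map_i_W, ρ.map_act]; abel
    simp only [map_add, map_sub, map_neg, e4, ρ.ρW_inv_self]
    simp only [mul_inv_rev, ρ.ρW_mul, e3, map_sub]
    abel
  · ext h f₀ f₁
    have e : ∀ w, ρ.ρ₁ f₀ (φ w) = ρ.ρW (X.i f₀) w - w := by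
      intro w; rw [ρ.map_i_W]; abel
    simp only [nabla₁, nabla₂, LinearMap.coe_mk, AddHom.coe_mk]
    simp only [Prod.snd_zero, Prod.fst_zero, Pi.zero_apply]
    simp only [map_add, map_sub, ρ.map_mul, X.mul_act, X.i_act, ρ.ρW_mul, ρ.ρW_self_inv, e]
    abel
  · rfl
  · ext g
    simp [nabla₁, nabla₂]
  · ext g₀ g₁
    simp only [nabla₁, nabla₂, LinearMap.coe_mk, AddHom.coe_mk]
    simp only [Prod.snd_zero, Prod.fst_zero, Pi.zero_apply]
    simp only [map_neg, ρ.map_mul, ρ.map_i_W]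
    abel
  · ext g₀ g₁ g₂
    simp only [nabla₁, nabla₂, LinearMap.coe_mk, AddHom.coe_mk]
    simp only [Prod.snd_zero, Pi.zero_apply]
    simp only [map_add, map_sub, X.i.map_mul, ρ.ρW_mul, mul_assoc]
    abel

theorem nabla₁_mem (c : PreCochain₁ X W V) (hc : c ∈ cochains₁ X W V) :
    nabla₁ ρ c ∈ cochains₂ X W V := by
  obtain ⟨a, b, v⟩ := c
  obtain ⟨sa, sb, ha, hb⟩ := hc
  change ContMDiff _ _ _ a at sa
  change ContMDiff _ _ _ b at sb
  change a 1 = 0 at ha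
  change b 1 = 0 at hb
  have hi := X.contMDiff_i
  have hact := X.contMDiff_act
  refine ⟨⟨?_, fun h => ?_, fun h => ?_⟩, ⟨?_, fun h => ?_, fun h => ?_⟩, ⟨?_, ?_⟩,
    ⟨?_, fun h => ?_, fun h => ?_⟩, ⟨?_, ?_⟩⟩ <;>
    simp only [nabla₁, LinearMap.coe_mk, AddHom.coe_mk]
  · exact (((ρ.contMDiff_ρV.comp contMDiff_fst).clm_apply (sa.comp contMDiff_snd)).sub
      (sa.comp (contMDiff_fst.mul contMDiff_snd))).add (sa.comp contMDiff_fst)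
  · simp [ha]
  · simp [ha]
  · have hinv : ContMDiff (𝓘(ℝ, X.𝔥).prod 𝓘(ℝ, X.𝔤)) 𝓘(ℝ, W →L[ℝ] W) ∞
        (fun p : X.H × X.G => ρ.ρW p.1⁻¹) := ρ.contMDiff_ρW.comp contMDiff_fst.inv
    exact (hinv.clm_apply ((ρ.contMDiff_ρ₁.comp contMDiff_snd).clm_apply
      (sa.comp contMDiff_fst))).sub ((sb.comp (hact.comp (contMDiff_snd.prodMk contMDiff_fst))).sub
      (hinv.clm_apply (sb.comp contMDiff_snd)))
  · simp [ha, X.act_one]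
  · simp [hb, X.one_act, ρ.ρ₁_one]
  · have ht : ContMDiff (𝓘(ℝ, X.𝔤).prod 𝓘(ℝ, X.𝔥)) 𝓘(ℝ, X.𝔥) ∞
        (fun p : X.G × X.H => p.2 * X.i p.1) := contMDiff_snd.mul (hi.comp contMDiff_fst)
    exact (((sa.comp contMDiff_snd).sub (sa.comp ht)).add
      (((ρ.contMDiff_ρV.comp ht).clm_apply contMDiff_const).sub contMDiff_const)).add
      ((ρ.contMDiff_ρV.comp contMDiff_snd).clm_apply
        (φ.contMDiff.comp (sb.comp contMDiff_fst)))
  · simp [hb]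
  · exact (((ρ.contMDiff_ρW.comp (hi.comp contMDiff_fst)).clm_apply (sb.comp contMDiff_snd)).sub
      (sb.comp (contMDiff_fst.mul contMDiff_snd))).add (sb.comp contMDiff_fst)
  · simp [hb]
  · simp [hb]
  · exact (ρ.contMDiff_ρ₁.clm_apply contMDiff_const).neg
  · simp [ρ.ρ₁_one]

/-- Coboundaries are cocycles. -/
theorem coboundaries₂_le_cocycles₂ : coboundaries₂ ρ ≤ cocycles₂ ρ := by
  rintro _ ⟨c, hc, rfl⟩
  exact ⟨nabla₁_mem ρ c hc, nabla₂_nabla₁ ρ c hc⟩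

end Square

/-! ### Extensions of a Lie 2-group by a 2-vector space -/

/-- An extension of the Lie 2-group `X` by the 2-vector space `φ : W → V` (regarded as a Lie
2-group, with trivial action): a Lie 2-group `E` with maps of Lie 2-groups `j` from `W → V` to `E`
and `π` from `E` to `X` such that `1 → W → E.G → X.G → 1` and `1 → V → E.H → X.H → 1` are short
exact sequences of Lie groups. -/
structure Extension (X : LieTwoGroup.{u}) {W V : Type u}
    [NormedAddCommGroup W] [NormedSpace ℝ W] [NormedAddCommGroup V] [NormedSpace ℝ V]
    (φ : W →L[ℝ] V) : Type (u + 1) where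
  E : LieTwoGroup.{u}
  j₁ : W → E.G
  j₀ : V → E.H
  π₁ : E.G →* X.G
  π₀ : E.H →* X.H
  j₁_add : ∀ w w', j₁ (w + w') = j₁ w * j₁ w'
  j₀_add : ∀ v v', j₀ (v + v') = j₀ v * j₀ v'
  isSmoothEmbedding_j₁ : Manifold.IsSmoothEmbedding 𝓘(ℝ, W) 𝓘(ℝ, E.𝔤) ∞ j₁
  isSmoothEmbedding_j₀ : Manifold.IsSmoothEmbedding 𝓘(ℝ, V) 𝓘(ℝ, E.𝔥) ∞ j₀
  contMDiff_π₁ : ContMDiff 𝓘(ℝ, E.𝔤) 𝓘(ℝ, X.𝔤) ∞ π₁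
  contMDiff_π₀ : ContMDiff 𝓘(ℝ, E.𝔥) 𝓘(ℝ, X.𝔥) ∞ π₀
  exact₁ : ∀ e, π₁ e = 1 ↔ e ∈ Set.range j₁
  exact₀ : ∀ x, π₀ x = 1 ↔ x ∈ Set.range j₀
  surjective_π₁ : Function.Surjective π₁
  surjective_π₀ : Function.Surjective π₀
  i_j : ∀ w, E.i (j₁ w) = j₀ (φ w)
  act_j : ∀ w v, E.act (j₁ w) (j₀ v) = j₁ w
  i_π : ∀ e, X.i (π₁ e) = π₀ (E.i e)
  act_π : ∀ e x, π₁ (E.act e x) = X.act (π₁ e) (π₀ x)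

namespace Extension

variable {X : LieTwoGroup.{u}} {W V : Type u}
  [NormedAddCommGroup W] [NormedSpace ℝ W] [NormedAddCommGroup V] [NormedSpace ℝ V]
  {φ : W →L[ℝ] V}

/-- A smooth splitting of an extension: smooth sections of the two projections, which need not be
group homomorphisms. -/
structure Splitting (E : Extension X φ) where
  σ₁ : X.G → E.E.G
  σ₀ : X.H → E.E.H
  contMDiff_σ₁ : ContMDiff 𝓘(ℝ, X.𝔤) 𝓘(ℝ, E.E.𝔤) ∞ σ₁
  contMDiff_σ₀ : ContMDiff 𝓘(ℝ, X.𝔥) 𝓘(ℝ, E.E.𝔥) ∞ σ₀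
  π_σ₁ : ∀ g, E.π₁ (σ₁ g) = g
  π_σ₀ : ∀ h, E.π₀ (σ₀ h) = h

/-- `ρ` is the 2-representation induced by the split extension `E` with splitting `σ`. -/
structure Splitting.Induces {E : Extension X φ} (σ : E.Splitting) (ρ : TwoRep X φ) : Prop where
  ρV_eq : ∀ h v, E.j₀ (ρ.ρV h v) = σ.σ₀ h * E.j₀ v * (σ.σ₀ h)⁻¹
  ρW_eq : ∀ h w, E.j₁ (ρ.ρW h w) = E.E.act (E.j₁ w) (σ.σ₀ h)⁻¹
  ρ₁_eq : ∀ g v, E.j₁ (ρ.ρ₁ g v) = E.E.act (σ.σ₁ g) (E.j₀ v) * (σ.σ₁ g)⁻¹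

/-- Equivalence of extensions: an isomorphism of Lie 2-groups compatible with the inclusions of
`W → V` and with the projections to `X`. -/
def IsEquivalent (E F : Extension X φ) : Prop :=
  ∃ (ψ₁ : E.E.G ≃* F.E.G) (ψ₀ : E.E.H ≃* F.E.H),
    (ContMDiff 𝓘(ℝ, E.E.𝔤) 𝓘(ℝ, F.E.𝔤) ∞ ψ₁ ∧ ContMDiff 𝓘(ℝ, F.E.𝔤) 𝓘(ℝ, E.E.𝔤) ∞ ψ₁.symm) ∧
    (ContMDiff 𝓘(ℝ, E.E.𝔥) 𝓘(ℝ, F.E.𝔥) ∞ ψ₀ ∧ ContMDiff 𝓘(ℝ, F.E.𝔥) 𝓘(ℝ, E.E.𝔥) ∞ ψ₀.symm) ∧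
    (∀ e, F.E.i (ψ₁ e) = ψ₀ (E.E.i e)) ∧
    (∀ e x, ψ₁ (E.E.act e x) = F.E.act (ψ₁ e) (ψ₀ x)) ∧
    (∀ w, ψ₁ (E.j₁ w) = F.j₁ w) ∧ (∀ v, ψ₀ (E.j₀ v) = F.j₀ v) ∧
    (∀ e, F.π₁ (ψ₁ e) = E.π₁ e) ∧ (∀ x, F.π₀ (ψ₀ x) = E.π₀ x)

theorem IsEquivalent.refl (E : Extension X φ) : E.IsEquivalent E :=
  ⟨MulEquiv.refl _, MulEquiv.refl _, ⟨contMDiff_id, contMDiff_id⟩, ⟨contMDiff_id, contMDiff_id⟩,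
    fun _ => rfl, fun _ _ => rfl, fun _ => rfl, fun _ => rfl, fun _ => rfl, fun _ => rfl⟩

theorem IsEquivalent.symm {E F : Extension X φ} (h : E.IsEquivalent F) : F.IsEquivalent E := by
  obtain ⟨a, b, ⟨h1, h2⟩, ⟨h3, h4⟩, h5, h6, h7, h8, h9, h10⟩ := h
  refine ⟨a.symm, b.symm, ⟨h2, h1⟩, ⟨h4, h3⟩, fun e => ?_, fun e x => ?_, fun w => ?_, fun v => ?_,
    fun e => ?_, fun x => ?_⟩
  · apply b.injective; simp [← h5]
  · apply a.injective; simp [h6]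
  · apply a.injective; simp [h7]
  · apply b.injective; simp [h8]
  · simp [← h9]
  · simp [← h10]

theorem IsEquivalent.trans {E F K : Extension X φ} (h : E.IsEquivalent F) (k : F.IsEquivalent K) :
    E.IsEquivalent K := by
  obtain ⟨a, b, ⟨h1, h2⟩, ⟨h3, h4⟩, h5, h6, h7, h8, h9, h10⟩ := h
  obtain ⟨c, d, ⟨k1, k2⟩, ⟨k3, k4⟩, k5, k6, k7, k8, k9, k10⟩ := k
  refine ⟨a.trans c, b.trans d, ⟨k1.comp h1, h2.comp k2⟩, ⟨k3.comp h3, h4.comp k4⟩,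
    fun e => ?_, fun e x => ?_, fun w => ?_, fun v => ?_, fun e => ?_, fun x => ?_⟩ <;>
  simp [*]

end Extension

section Classification

variable {X : LieTwoGroup.{u}} {W V : Type u}
  [NormedAddCommGroup W] [NormedSpace ℝ W] [NormedAddCommGroup V] [NormedSpace ℝ V]
  {φ : W →L[ℝ] V}

/-- The split extensions of `X` by `φ : W → V` whose induced 2-representation is `ρ`. -/
abbrev SplitExtension (ρ : TwoRep X φ) : Type (u + 1) :=
  {E : Extension X φ // ∃ σ : E.Splitting, σ.Induces ρ}

instance SplitExtension.setoid (ρ : TwoRep X φ) : Setoid (SplitExtension ρ) where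
  r E F := E.1.IsEquivalent F.1
  iseqv := ⟨fun E => .refl E.1, fun h => h.symm, fun h k => h.trans k⟩

/-- Equivalence classes of split extensions of `X` by `φ : W → V` inducing `ρ`. -/
abbrev ExtensionClass (ρ : TwoRep X φ) : Type (u + 1) := Quotient (SplitExtension.setoid ρ)

variable (X W V) in
/-- A 4-tuple `(ω₀, ω₁, α, χ)` of smooth maps, in `C(H², V) ⊕ C(G², W) ⊕ C(H × G, W) ⊕ C(G, V)`. -/
structure FourTuple where
  ω₀ : X.H → X.H → V
  ω₁ : X.G → X.G → W
  α : X.H → X.G → W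
  χ : X.G → V
  contMDiff_ω₀ : ContMDiff (𝓘(ℝ, X.𝔥).prod 𝓘(ℝ, X.𝔥)) 𝓘(ℝ, V) ∞ (fun p : X.H × X.H => ω₀ p.1 p.2)
  contMDiff_ω₁ : ContMDiff (𝓘(ℝ, X.𝔤).prod 𝓘(ℝ, X.𝔤)) 𝓘(ℝ, W) ∞ (fun p : X.G × X.G => ω₁ p.1 p.2)
  contMDiff_α : ContMDiff (𝓘(ℝ, X.𝔥).prod 𝓘(ℝ, X.𝔤)) 𝓘(ℝ, W) ∞ (fun p : X.H × X.G => α p.1 p.2)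
  contMDiff_χ : ContMDiff 𝓘(ℝ, X.𝔤) 𝓘(ℝ, V) ∞ χ

/-- The 2-cochain `(ω₀, α, χ̂, ω₁, 0, 0)` attached to a 4-tuple, where
`χ̂ (g, h) = ω₀ (h, i g) + ρ₀⁰(h) (χ g)`. -/
def FourTuple.toCochain (ρ : TwoRep X φ) (τ : FourTuple X W V) : PreCochain₂ X W V :=
  (τ.ω₀, τ.α, fun g h => τ.ω₀ h (X.i g) + ρ.ρV h (τ.χ g), τ.ω₁, 0, 0)

/-- The 4-tuple `τ` defines the extension `E`: up to diffeomorphisms `Θ₀ : H × V → E.H` and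
`Θ₁ : G × W → E.G`, the Lie group `E.H` is `H × V` with the product twisted by `ω₀`, the Lie group
`E.G` is `G × W` with the product twisted by `ω₁`, the structural map and the action of `E` are
`(g, w) ↦ (i g, φ w + χ g)` and
`(g, w) ^ (h, v) = (g ^ h, ρ₀¹(h)⁻¹ (w + ρ₁(g) v) + α(h; g))`, and the inclusions and projections
of `E` are the obvious ones. -/
def FourTuple.Defines (ρ : TwoRep X φ) (τ : FourTuple X W V) (E : Extension X φ) : Prop :=
  ∃ (Θ₁ : Diffeomorph (𝓘(ℝ, X.𝔤).prod 𝓘(ℝ, W)) 𝓘(ℝ, E.E.𝔤) (X.G × W) E.E.G ∞)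
    (Θ₀ : Diffeomorph (𝓘(ℝ, X.𝔥).prod 𝓘(ℝ, V)) 𝓘(ℝ, E.E.𝔥) (X.H × V) E.E.H ∞),
    (∀ h₀ v₀ h₁ v₁,
      Θ₀ (h₀, v₀) * Θ₀ (h₁, v₁) = Θ₀ (h₀ * h₁, v₀ + ρ.ρV h₀ v₁ + τ.ω₀ h₀ h₁)) ∧
    (∀ g₀ w₀ g₁ w₁,
      Θ₁ (g₀, w₀) * Θ₁ (g₁, w₁) = Θ₁ (g₀ * g₁, w₀ + ρ.ρW (X.i g₀) w₁ + τ.ω₁ g₀ g₁)) ∧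
    (∀ g w, E.E.i (Θ₁ (g, w)) = Θ₀ (X.i g, φ w + τ.χ g)) ∧
    (∀ g w h v, E.E.act (Θ₁ (g, w)) (Θ₀ (h, v)) =
      Θ₁ (X.act g h, ρ.ρW h⁻¹ (w + ρ.ρ₁ g v) + τ.α h g)) ∧
    (∀ w, E.j₁ w = Θ₁ (1, w)) ∧ (∀ v, E.j₀ v = Θ₀ (1, v)) ∧
    (∀ g w, E.π₁ (Θ₁ (g, w)) = g) ∧ (∀ h v, E.π₀ (Θ₀ (h, v)) = h)

end Classification

/-! A splitting trivialises a split extension: every element of `E.H` is uniquely `j₀ v * σ₀ h`, and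
every element of `E.G` is uniquely `j₁ w * σ₁ g`. In these coordinates the crossed module is given
by the induced 2-representation, which records how fibre elements move past section elements, and by
four remainders ω₀, ω₁, α, χ, which measure how far the sections fail to respect the two products,
the action and the structural map. The 2-representation does not see the splitting: V and W are
abelian and V acts trivially on W, so multiplying a section by fibre elements changes none of its
operators (`Splitting.induces_iff`).

Conversely, the twisted formulas define an extension exactly when the fibre component of each axiom
holds; these identities form `FourTuple.IsExtensionData`. They are equivalent to the cocycle
equations: some components of ∇ are such identities up to sign; the mixed ones specialise to the
remaining identities at unit arguments, and follow back from them by translating with ρ and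
rebracketing with the group cocycle identities. The component v of a general cocycle is removed by
∇(0, 0, v), and what remains comes from a 4-tuple.

An equivalence lies over the identity of X and fixes the fibres V and W, so in coordinates it is a
pair of shears (h, v) ↦ (h, v + lam₀ h), (g, w) ↦ (g, w + lam₁ g). Its compatibility with the
structure says that the two cocycles differ by ∇(lam₀, lam₁, 0).

Two facts carry the smoothness: j₀ and j₁ are smooth embeddings, so smooth maps into the kernels of
the projections lift smoothly to V and W; and on a finite-dimensional space an operator-valued map
is smooth once its value on each vector is. -/

/-! ### Fibres of a product as smooth embeddings. -/

section FibreInclusion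

open Manifold

/-- The local normal form of an immersion is u ↦ (u, 0), so the chart in the complementary direction
must send the base point to 0; translating a chart achieves this. -/
theorem IsManifold.exists_centered_chart {𝔨 K : Type*} [NormedAddCommGroup 𝔨] [NormedSpace ℝ 𝔨]
    [TopologicalSpace K] [ChartedSpace 𝔨 K] [IsManifold 𝓘(ℝ, 𝔨) ∞ K] (a : K) :
    ∃ e ∈ IsManifold.maximalAtlas 𝓘(ℝ, 𝔨) ∞ K, a ∈ e.source ∧ e a = 0 := by
  have hc := IsManifold.chart_mem_maximalAtlas (I := 𝓘(ℝ, 𝔨)) (n := ∞) a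
  refine ⟨(chartAt 𝔨 a).transHomeomorph (Homeomorph.addRight (-chartAt 𝔨 a a)), ?_, ?_, ?_⟩
  · refine OpenPartialHomeomorph.mem_maximalAtlas_of_contMDiffOn _ ?_ ?_
    · exact (contMDiffOn_of_mem_maximalAtlas hc).add contMDiffOn_const
    · exact (contMDiffOn_symm_of_mem_maximalAtlas hc).comp
        (contMDiffOn_id.add contMDiffOn_const) (fun x hx => hx)
  · exact mem_chart_source 𝔨 a
  · simp

/-- The inclusion of a fibre in a product of manifolds is a smooth embedding. -/
theorem Manifold.isSmoothEmbedding_prodMk_left {𝔨 K U : Type*}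
    [NormedAddCommGroup 𝔨] [NormedSpace ℝ 𝔨]
    [TopologicalSpace K] [ChartedSpace 𝔨 K] [IsManifold 𝓘(ℝ, 𝔨) ∞ K]
    [NormedAddCommGroup U] [NormedSpace ℝ U] (a : K) :
    IsSmoothEmbedding 𝓘(ℝ, U) (𝓘(ℝ, 𝔨).prod 𝓘(ℝ, U)) ∞ (fun u : U => (a, u)) := by
  obtain ⟨e, he, ha, h0⟩ := IsManifold.exists_centered_chart (𝔨 := 𝔨) a
  refine ⟨IsImmersionOfComplement.isImmersion (F := 𝔨) fun u => ?_, isEmbedding_prodMkRight a⟩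
  -- The normal form puts the complement second, the product K × U puts it first; hence the swap.
  refine IsImmersionAtOfComplement.mk_of_charts (ContinuousLinearEquiv.prodComm ℝ U 𝔨)
    (chartAt U u) (e.prod (chartAt U u)) (mem_chart_source U u) ⟨ha, mem_chart_source U u⟩
    (IsManifold.chart_mem_maximalAtlas u)
    (IsManifold.mem_maximalAtlas_prod he (IsManifold.chart_mem_maximalAtlas u))
    (fun x hx => ⟨ha, hx⟩) fun x _ => ?_
  simp [h0, chartAt_self_eq]

end FibreInclusion

/-! ### The Lie group twisted by a 2-cocycle. -/

section TwistedProduct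

/-- A smooth normalised 2-cocycle of a Lie group `K`, modelled on `𝔨`, with values in a smooth
linear representation on `U`. -/
structure GroupTwoCocycle (𝔨 K U : Type*) [NormedAddCommGroup 𝔨] [NormedSpace ℝ 𝔨]
    [Group K] [TopologicalSpace K] [ChartedSpace 𝔨 K]
    [NormedAddCommGroup U] [NormedSpace ℝ U] where
  R : K →* (U →L[ℝ] U)
  f : K → K → U
  one_left : ∀ k, f 1 k = 0
  one_right : ∀ k, f k 1 = 0
  cocycle : ∀ a b c, R a (f b c) + f a (b * c) = f (a * b) c + f a b
  contMDiff_R : ContMDiff 𝓘(ℝ, 𝔨) 𝓘(ℝ, U →L[ℝ] U) ∞ R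
  contMDiff_f : ContMDiff (𝓘(ℝ, 𝔨).prod 𝓘(ℝ, 𝔨)) 𝓘(ℝ, U) ∞ (fun p : K × K => f p.1 p.2)

namespace GroupTwoCocycle

variable {𝔨 K U : Type*} [NormedAddCommGroup 𝔨] [NormedSpace ℝ 𝔨]
  [Group K] [TopologicalSpace K] [ChartedSpace 𝔨 K]
  [NormedAddCommGroup U] [NormedSpace ℝ U]

/-- The product `K × U`, to be endowed with the group structure twisted by a cocycle. -/
@[nolint unusedArguments]
def Product (_ : GroupTwoCocycle 𝔨 K U) := K × U

variable (c : GroupTwoCocycle 𝔨 K U)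

instance : Mul c.Product := ⟨fun a b => (a.1 * b.1, a.2 + c.R a.1 b.2 + c.f a.1 b.1)⟩
instance : One c.Product := ⟨(1, 0)⟩
-- The fibre component is solved from the left inverse equation, which is the one that
-- `Group.ofLeftAxioms` asks for.
instance : Inv c.Product := ⟨fun a => (a.1⁻¹, -c.R a.1⁻¹ a.2 - c.f a.1⁻¹ a.1)⟩

/-- The element of the twisted product with the given components. -/
def el (k : K) (u : U) : c.Product := (k, u)

theorem el_mul (a : K) (u : U) (b : K) (v : U) :
    c.el a u * c.el b v = c.el (a * b) (u + c.R a v + c.f a b) := rfl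

theorem R_mul (a b : K) (u : U) : c.R (a * b) u = c.R a (c.R b u) := by
  simp

instance : Group c.Product :=
  Group.ofLeftAxioms
    (by
      rintro ⟨k₀, u₀⟩ ⟨k₁, u₁⟩ ⟨k₂, u₂⟩
      change c.el k₀ u₀ * c.el k₁ u₁ * c.el k₂ u₂ = c.el k₀ u₀ * (c.el k₁ u₁ * c.el k₂ u₂)
      simp only [el_mul, mul_assoc, map_add, R_mul]
      congr 1
      linear_combination (norm := abel) -(c.cocycle k₀ k₁ k₂))
    (by
      rintro ⟨k, u⟩
      change c.el 1 0 * c.el k u = c.el k u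
      simp [el_mul, c.one_left])
    (by
      rintro ⟨k, u⟩
      change c.el k⁻¹ _ * c.el k u = c.el 1 0
      simp [el_mul, sub_eq_add_neg])

instance : TopologicalSpace c.Product := inferInstanceAs (TopologicalSpace (K × U))

instance : ChartedSpace (𝔨 × U) c.Product :=
  inferInstanceAs (ChartedSpace (ModelProd 𝔨 U) (K × U))

variable {c} in
-- A `LieTwoGroup` needs charts in one normed space, here 𝔨 × U, while smoothness of pairs is stated
-- for the product of the two models. This lemma and the next pass between the two.
theorem contMDiff_product_iff {E H M : Type*} [NormedAddCommGroup E] [NormedSpace ℝ E]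
    [TopologicalSpace H] {I : ModelWithCorners ℝ E H} [TopologicalSpace M] [ChartedSpace H M]
    {F : M → c.Product} :
    ContMDiff I 𝓘(ℝ, 𝔨 × U) ∞ F ↔
      ContMDiff I (𝓘(ℝ, 𝔨).prod 𝓘(ℝ, U)) ∞ (fun x => ((F x).1, (F x).2)) := by
  rw [modelWithCornersSelf_prod]
  rfl

theorem contMDiff_toProd :
    ContMDiff 𝓘(ℝ, 𝔨 × U) (𝓘(ℝ, 𝔨).prod 𝓘(ℝ, U)) ∞ (fun p : c.Product => (p.1, p.2)) := by
  rw [modelWithCornersSelf_prod]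
  exact contMDiff_id

theorem contMDiff_fst : ContMDiff 𝓘(ℝ, 𝔨 × U) 𝓘(ℝ, 𝔨) ∞ (fun p : c.Product => p.1) :=
  _root_.contMDiff_fst.comp c.contMDiff_toProd

theorem contMDiff_snd : ContMDiff 𝓘(ℝ, 𝔨 × U) 𝓘(ℝ, U) ∞ (fun p : c.Product => p.2) :=
  _root_.contMDiff_snd.comp c.contMDiff_toProd

variable [LieGroup 𝓘(ℝ, 𝔨) ∞ K]

instance : IsManifold 𝓘(ℝ, 𝔨 × U) ∞ c.Product := by
  rw [modelWithCornersSelf_prod]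
  exact inferInstanceAs (IsManifold (𝓘(ℝ, 𝔨).prod 𝓘(ℝ, U)) ∞ (K × U))

instance : LieGroup 𝓘(ℝ, 𝔨 × U) ∞ c.Product where
  contMDiff_mul := by
    have h1 := c.contMDiff_fst.comp
      (_root_.contMDiff_fst (I := 𝓘(ℝ, 𝔨 × U)) (J := 𝓘(ℝ, 𝔨 × U)) (M := c.Product) (N := c.Product))
    have h2 := c.contMDiff_fst.comp
      (_root_.contMDiff_snd (I := 𝓘(ℝ, 𝔨 × U)) (J := 𝓘(ℝ, 𝔨 × U)) (M := c.Product) (N := c.Product))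
    have k1 := c.contMDiff_snd.comp
      (_root_.contMDiff_fst (I := 𝓘(ℝ, 𝔨 × U)) (J := 𝓘(ℝ, 𝔨 × U)) (M := c.Product) (N := c.Product))
    have k2 := c.contMDiff_snd.comp
      (_root_.contMDiff_snd (I := 𝓘(ℝ, 𝔨 × U)) (J := 𝓘(ℝ, 𝔨 × U)) (M := c.Product) (N := c.Product))
    exact contMDiff_product_iff.2 ((h1.mul h2).prodMk
      ((k1.add ((c.contMDiff_R.comp h1).clm_apply k2)).add (c.contMDiff_f.comp (h1.prodMk h2))))
  contMDiff_inv := by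
    have h := c.contMDiff_fst.inv
    exact contMDiff_product_iff.2 (h.prodMk
      ((((c.contMDiff_R.comp h).clm_apply c.contMDiff_snd).neg).sub
        (c.contMDiff_f.comp (h.prodMk c.contMDiff_fst))))

theorem isSmoothEmbedding_el_one :
    Manifold.IsSmoothEmbedding 𝓘(ℝ, U) 𝓘(ℝ, 𝔨 × U) ∞ (c.el 1) := by
  rw [modelWithCornersSelf_prod]
  exact Manifold.isSmoothEmbedding_prodMk_left 1

end GroupTwoCocycle

end TwistedProduct

/-! ### Extension axioms in coordinates and cocycle equations. -/

section ExtensionData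

variable {X : LieTwoGroup.{u}} {W V : Type u}
  [NormedAddCommGroup W] [NormedSpace ℝ W] [NormedAddCommGroup V] [NormedSpace ℝ V]
  {φ : W →L[ℝ] V}

theorem nabla₂_eq_zero_iff (ρ : TwoRep X φ) {f₀ : X.H → X.H → V} {α : X.H → X.G → W}
    {χ : X.G → X.H → V} {f₁ : X.G → X.G → W} {lam : X.G → W} {v : V} :
    nabla₂ ρ (f₀, α, χ, f₁, lam, v) = 0 ↔
    (∀ h₀ h₁ h₂, ρ.ρV h₀ (f₀ h₁ h₂) - f₀ (h₀ * h₁) h₂ + f₀ h₀ (h₁ * h₂) - f₀ h₀ h₁ = 0) ∧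
    (∀ g₀ h₀ g₁ h₁, - (f₀ h₀ h₁ - f₀ (h₀ * X.i g₀) (h₁ * X.i g₁))
      + (ρ.ρV (h₀ * X.i g₀) (χ g₁ h₁) - χ (X.act g₀ h₁ * g₁) (h₀ * h₁) + χ g₀ h₀)
      - ρ.ρV (h₀ * h₁) (φ (α h₁ g₀))
      - ρ.ρV (h₀ * h₁) (φ (f₁ (X.act g₀ h₁) g₁)) = 0) ∧
    (∀ h₀ h₁ f, ρ.ρW (h₀ * h₁)⁻¹ (ρ.ρ₁ f (f₀ h₀ h₁))
      - (α h₁ (X.act f h₀) - α (h₀ * h₁) f + ρ.ρW h₁⁻¹ (α h₀ f)) = 0) ∧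
    (∀ g₀ g₁ h, (χ g₁ h - χ (g₁ * g₀) h + χ g₀ (h * X.i g₁))
      + (ρ.ρV (h * X.i (g₁ * g₀)) v - v)
      - ρ.ρV (h * X.i g₁) (φ (lam g₀))
      - ρ.ρV h (φ (f₁ g₁ g₀)) = 0) ∧
    (∀ g h f, - ρ.ρW (h * X.i g)⁻¹ (ρ.ρ₁ f (χ g h))
      + (ρ.ρW (X.i g)⁻¹ (α h f) - α (h * X.i g) f)
      - (lam (X.act f (h * X.i g)) - ρ.ρW (h * X.i g)⁻¹ (lam f))
      + (ρ.ρW (X.i g)⁻¹ (f₁ (X.act f h) g) + f₁ g⁻¹ (X.act f h * g) - f₁ g⁻¹ g) = 0) ∧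
    (∀ h a b, (ρ.ρW (X.i (X.act a h)) (α h b) - α h (a * b) + α h a)
      + (f₁ (X.act a h) (X.act b h) - ρ.ρW h⁻¹ (f₁ a b)) = 0) ∧
    (∀ g, ρ.ρ₁ g v - lam g = 0) ∧
    (∀ g₀ g₁, - (ρ.ρW (X.i g₀) (lam g₁) - lam (g₀ * g₁) + lam g₀) = 0) ∧
    (∀ a b c, ρ.ρW (X.i a) (f₁ b c) - f₁ (a * b) c + f₁ a (b * c) - f₁ a b = 0) := by
  simp only [nabla₂, LinearMap.coe_mk, AddHom.coe_mk, Prod.mk_eq_zero, funext_iff, Prod.forall,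
    Pi.zero_apply, true_and]

/-- The identities between the components of a 4-tuple which say that the twisted products
`H × V` and `G × W` form a crossed module extending `X`. -/
structure FourTuple.IsExtensionData (ρ : TwoRep X φ) (τ : FourTuple X W V) : Prop where
  ω₀_one_left : ∀ h, τ.ω₀ 1 h = 0
  ω₀_one_right : ∀ h, τ.ω₀ h 1 = 0
  ω₁_one_left : ∀ g, τ.ω₁ 1 g = 0
  ω₁_one_right : ∀ g, τ.ω₁ g 1 = 0
  α_one_left : ∀ g, τ.α 1 g = 0
  α_one_right : ∀ h, τ.α h 1 = 0
  χ_one : τ.χ 1 = 0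
  ω₀_cocycle : ∀ a b c,
    ρ.ρV a (τ.ω₀ b c) + τ.ω₀ a (b * c) = τ.ω₀ (a * b) c + τ.ω₀ a b
  ω₁_cocycle : ∀ a b c,
    ρ.ρW (X.i a) (τ.ω₁ b c) + τ.ω₁ a (b * c) = τ.ω₁ (a * b) c + τ.ω₁ a b
  χ_mul : ∀ a b, τ.χ a + ρ.ρV (X.i a) (τ.χ b) + τ.ω₀ (X.i a) (X.i b) =
    τ.χ (a * b) + φ (τ.ω₁ a b)
  α_mul_left : ∀ a b g, τ.α (a * b) g + ρ.ρW (a * b)⁻¹ (ρ.ρ₁ g (τ.ω₀ a b)) =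
    τ.α b (X.act g a) + ρ.ρW b⁻¹ (τ.α a g)
  α_mul_right : ∀ h a b, τ.α h (a * b) + ρ.ρW h⁻¹ (τ.ω₁ a b) =
    τ.α h a + ρ.ρW (X.i (X.act a h)) (τ.α h b) + τ.ω₁ (X.act a h) (X.act b h)
  χ_act : ∀ g h, ρ.ρV h (φ (τ.α h g)) + ρ.ρV h (τ.χ (X.act g h)) + τ.ω₀ h (X.i (X.act g h)) =
    τ.χ g + τ.ω₀ (X.i g) h
  peiffer : ∀ f g, ρ.ρ₁ f (τ.χ g) + ρ.ρW (X.i g) (τ.α (X.i g) f) + τ.ω₁ g (g⁻¹ * f * g) =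
    τ.ω₁ f g

/-- Smoothness is built into 4-tuples, so only normalisation is left. At the identity arrow χ̂
equals ω₀(1, 1) + χ(1), which reduces to χ(1). -/
theorem FourTuple.toCochain_mem_cochains₂_iff (ρ : TwoRep X φ) (τ : FourTuple X W V) :
    τ.toCochain ρ ∈ cochains₂ X W V ↔ (∀ h, τ.ω₀ 1 h = 0) ∧ (∀ h, τ.ω₀ h 1 = 0) ∧
      (∀ g, τ.α 1 g = 0) ∧ (∀ h, τ.α h 1 = 0) ∧ τ.χ 1 = 0 ∧
      (∀ g, τ.ω₁ 1 g = 0) ∧ (∀ g, τ.ω₁ g 1 = 0) := by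
  constructor
  · rintro ⟨⟨-, h1, h2⟩, ⟨-, h3, h4⟩, ⟨-, h5⟩, ⟨-, h6, h7⟩, -⟩
    refine ⟨h1, h2, h3, h4, ?_, h6, h7⟩
    have : τ.ω₀ 1 (X.i 1) + ρ.ρV 1 (τ.χ 1) = 0 := h5
    have h1' : τ.ω₀ 1 1 = 0 := h1 1
    simpa [h1'] using this
  · rintro ⟨h1, h2, h3, h4, h5, h6, h7⟩
    refine ⟨⟨τ.contMDiff_ω₀, h1, h2⟩, ⟨τ.contMDiff_α, h3, h4⟩, ⟨?_, ?_⟩,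
      ⟨τ.contMDiff_ω₁, h6, h7⟩, ⟨contMDiff_const, rfl⟩⟩
    · exact (τ.contMDiff_ω₀.comp (contMDiff_snd.prodMk (X.contMDiff_i.comp contMDiff_fst))).add
        ((ρ.contMDiff_ρV.comp contMDiff_snd).clm_apply (τ.contMDiff_χ.comp contMDiff_fst))
    · change τ.ω₀ 1 (X.i 1) + ρ.ρV 1 (τ.χ 1) = 0
      simp [h1, h5]

/-- Three identities come from specialising mixed components of ∇: `χ_mul` is the (2,1) component at
h = 1, `χ_act` is the (1,2) component at the arrows (g, 1) and (1, h), and `peiffer` is the (1,1)_1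
component at h = 1. The others are components up to sign, or normalisations. -/
theorem FourTuple.isExtensionData_of_mem_cocycles₂ {ρ : TwoRep X φ} {τ : FourTuple X W V}
    (hτ : τ.toCochain ρ ∈ cocycles₂ ρ) : τ.IsExtensionData ρ := by
  obtain ⟨hn, hc⟩ := hτ
  obtain ⟨n1, n2, n3, n4, n5, n6, n7⟩ := (τ.toCochain_mem_cochains₂_iff ρ).1 hn
  obtain ⟨c1, c2, c3, c4, c5, c6, -, -, c9⟩ := (nabla₂_eq_zero_iff ρ).1 hc
  have hω : ∀ a b c, ρ.ρW (X.i a) (τ.ω₁ b c) + τ.ω₁ a (b * c) = τ.ω₁ (a * b) c + τ.ω₁ a b :=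
    fun a b c => by linear_combination (norm := abel) c9 a b c
  refine ⟨n1, n2, n6, n7, n3, n4, n5, fun a b c => ?_, hω, fun a b => ?_, fun a b g => ?_,
    fun h a b => ?_, fun g h => ?_, fun f g => ?_⟩
  · linear_combination (norm := abel) c1 a b c
  · have := c4 b a 1
    simp only [one_mul, n1, map_one, one_apply_eq_self, zero_add, map_zero,
      sub_self, Pi.zero_apply] at this
    linear_combination (norm := abel) this
  · linear_combination (norm := abel) c3 a b g
  · linear_combination (norm := abel) -(c6 h a b)
  · have := c2 g 1 1 h
    simp only [one_mul, mul_one, n1, n2, n5, n7, map_one, one_apply_eq_self, zero_add,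
      map_zero, sub_zero] at this
    linear_combination (norm := abel) -this
  · have h1 := c5 g 1 f
    simp only [one_mul, n1, n3, X.act_one, map_one, one_apply_eq_self, zero_add,
      map_zero, sub_self, sub_zero, Pi.zero_apply] at h1
    have h2 := congrArg (ρ.ρW (X.i g)) h1
    simp only [map_add, map_sub, map_neg, ρ.ρW_self_inv, map_zero] at h2
    -- These two cocycle identities trade ω₁(g⁻¹, f g) and ω₁(g⁻¹, g) for values of ω₁ at g; the
    -- common term ω₁(g, g⁻¹) cancels in the difference.
    have h3 := hω g g⁻¹ (f * g)
    have h4 := hω g g⁻¹ g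
    simp only [mul_inv_cancel, inv_mul_cancel, n6, n7] at h3 h4
    rw [mul_assoc]
    linear_combination (norm := abel) -h2 + h3 - h4

theorem FourTuple.IsExtensionData.toCochain_mem_cocycles₂ {ρ : TwoRep X φ} {τ : FourTuple X W V}
    (d : τ.IsExtensionData ρ) : τ.toCochain ρ ∈ cocycles₂ ρ := by
  refine ⟨(τ.toCochain_mem_cochains₂_iff ρ).2 ⟨d.ω₀_one_left, d.ω₀_one_right, d.α_one_left,
    d.α_one_right, d.χ_one, d.ω₁_one_left, d.ω₁_one_right⟩,
    (nabla₂_eq_zero_iff ρ).2 ⟨fun a b c => ?_, fun g₀ h₀ g₁ h₁ => ?_, fun a b g => ?_,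
      fun g₀ g₁ h => ?_, fun g h f => ?_, fun h a b => ?_, fun g => ?_, fun g₀ g₁ => ?_,
      fun a b c => ?_⟩⟩
  · linear_combination (norm := abel) d.ω₀_cocycle a b c
  -- The products h₀ i(g₀) h₁ i(g₁) and h₀ h₁ i(g₀^h₁) i(g₁) agree. The four instances of the
  -- cocycle identity rebracket ω₀ between the two, and `e5`, `e6` are the homomorphism and
  -- equivariance identities translated by ρ.
  · have hc : h₁ * X.i (X.act g₀ h₁) = X.i g₀ * h₁ := by rw [X.i_act]; group
    have e1 := d.ω₀_cocycle (h₀ * X.i g₀) h₁ (X.i g₁)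
    have e2 := d.ω₀_cocycle h₀ (X.i g₀) h₁
    have e3 := d.ω₀_cocycle (h₀ * h₁) (X.i (X.act g₀ h₁)) (X.i g₁)
    have e4 := d.ω₀_cocycle h₀ h₁ (X.i (X.act g₀ h₁))
    have e5 := congrArg (ρ.ρV (h₀ * h₁)) (d.χ_mul (X.act g₀ h₁) g₁)
    have e6 := congrArg (ρ.ρV h₀) (d.χ_act g₀ h₁)
    have e7 (v : V) : ρ.ρV h₁ (ρ.ρV (X.i (X.act g₀ h₁)) v) = ρ.ρV (X.i g₀) (ρ.ρV h₁ v) := by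
      rw [← ρ.ρV_mul, hc, ρ.ρV_mul]
    simp only [mul_assoc, hc] at e1 e2 e3 e4
    simp only [X.i.map_mul, map_add, ρ.ρV_mul, e7] at e1 e2 e3 e4 e5 e6 ⊢
    linear_combination (norm := abel) e1 - e2 - e3 + e4 + e5 - e6
  · linear_combination (norm := abel) d.α_mul_left a b g
  · have e1 := congrArg (ρ.ρV h) (d.χ_mul g₁ g₀)
    have e2 := d.ω₀_cocycle h (X.i g₁) (X.i g₀)
    simp only [map_add, X.i.map_mul, ρ.ρV_mul, map_zero, Pi.zero_apply] at e1 e2 ⊢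
    linear_combination (norm := abel) e1 - e2
  -- The Peiffer identity at f^h covers the terms in ω₁; the terms in α are joined by the action
  -- identity for the product h i(g).
  · have h1 := d.peiffer (X.act f h) g
    have h2 := congrArg (ρ.ρW (X.i g)⁻¹) h1
    have h3 := congrArg (ρ.ρW (X.i g)⁻¹) (d.ω₁_cocycle g g⁻¹ (X.act f h * g))
    have h4 := congrArg (ρ.ρW (X.i g)⁻¹) (d.ω₁_cocycle g g⁻¹ g)
    have h5 := d.α_mul_left h (X.i g) f
    simp only [mul_inv_cancel, inv_mul_cancel, d.ω₁_one_left, d.ω₁_one_right] at h3 h4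
    simp only [mul_inv_rev, ρ.ρW_mul, map_add, map_zero, ρ.ρW_inv_self, ρ.map_act,
      Pi.zero_apply, mul_assoc] at h2 h3 h4 h5 ⊢
    linear_combination (norm := abel) -h2 + h3 - h4 - h5
  · linear_combination (norm := abel) -(d.α_mul_right h a b)
  · simp
  · simp
  · linear_combination (norm := abel) d.ω₁_cocycle a b c

/-- With v = 0 the (2,0)_1 component forces lam = 0, and χ can only be the restriction of the arrow
component to arrows (g, 1). The (1,2) component at (1, h) and (g, 1) shows that this restriction
determines all other values. -/
theorem FourTuple.existsUnique_toCochain_eq {ρ : TwoRep X φ} {c : PreCochain₂ X W V}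
    (hc : c ∈ cocycles₂ ρ) (hv : c.2.2.2.2.2 = 0) : ∃! τ : FourTuple X W V, τ.toCochain ρ = c := by
  obtain ⟨f₀, α, χ, f₁, lam, v⟩ := c
  obtain rfl : v = 0 := hv
  obtain ⟨⟨⟨s1, -, n1⟩, ⟨s2, -, n2⟩, ⟨s3, n3⟩, ⟨s4, n4, -⟩, -⟩, hz⟩ := hc
  obtain ⟨-, c2, -, c4, -, -, c7, -, -⟩ := (nabla₂_eq_zero_iff ρ).1 hz
  have hlam : lam = 0 := by
    funext g
    simpa using c7 g
  subst hlam
  -- Normalisation only gives this at h = 1; for the other unit arrows it is the (2,1) component at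
  -- g₀ = g₁ = 1.
  have hone : ∀ h, χ 1 h = 0 := fun h => by
    have h1 := c4 1 1 h
    have h2 : f₁ 1 1 = 0 := n4 1
    simpa [h2] using h1
  have hχ : ∀ g h, f₀ h (X.i g) + ρ.ρV h (χ g 1) = χ g h := fun g h => by
    have h1 := c2 1 h g 1
    have h2 : f₁ 1 g = 0 := n4 g
    have h3 : f₀ h 1 = 0 := n1 h
    have h4 : α 1 1 = 0 := n2 1
    simp only [X.one_act, map_one, one_mul, mul_one, h2, h3, h4, hone, map_zero, sub_zero,
      add_zero] at h1
    linear_combination (norm := abel) h1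
  refine ⟨⟨f₀, f₁, α, fun g => χ g 1, s1, s4, s2,
    s3.comp (contMDiff_id.prodMk contMDiff_const)⟩, ?_, ?_⟩
  · simp only [toCochain, hχ]
  · rintro ⟨f₀', f₁', α', χ', t1, t2, t3, t4⟩ h
    simp only [toCochain, Prod.mk.injEq] at h
    obtain ⟨rfl, rfl, h, rfl, -, -⟩ := h
    congr
    funext g
    have h1 := congrFun (congrFun h g) 1
    have h2 := hχ g 1
    rw [← h2] at h1
    simpa using h1

/-- The last component of ∇(0, 0, v) is -v, so adding this coboundary kills the component v of the
cocycle. -/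
theorem FourTuple.exists_toCochain_cohomologous {ρ : TwoRep X φ} {c : PreCochain₂ X W V}
    (hc : c ∈ cocycles₂ ρ) : ∃ τ : FourTuple X W V, τ.toCochain ρ ∈ cocycles₂ ρ ∧
      c - τ.toCochain ρ ∈ coboundaries₂ ρ := by
  have hb : nabla₁ ρ (0, 0, c.2.2.2.2.2) ∈ coboundaries₂ ρ :=
    ⟨_, ⟨contMDiff_const, contMDiff_const, rfl, rfl⟩, rfl⟩
  have hc' := add_mem hc (coboundaries₂_le_cocycles₂ ρ hb)
  obtain ⟨τ, hτ, -⟩ := existsUnique_toCochain_eq hc' (by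
    change c.2.2.2.2.2 + -c.2.2.2.2.2 = 0
    simp)
  refine ⟨τ, hτ ▸ hc', ?_⟩
  rw [hτ, sub_add_cancel_left]
  exact neg_mem hb

end ExtensionData

/-! ### The extension defined by a 4-tuple. -/

section DefinedExtension

variable {X : LieTwoGroup.{u}} {W V : Type u}
  [NormedAddCommGroup W] [NormedSpace ℝ W] [NormedAddCommGroup V] [NormedSpace ℝ V]
  {φ : W →L[ℝ] V} {ρ : TwoRep X φ} {τ : FourTuple X W V}

namespace FourTuple.IsExtensionData

/-- The cocycle of `H` with values in `V` underlying a 4-tuple. -/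
def cocycleH (d : τ.IsExtensionData ρ) : GroupTwoCocycle X.𝔥 X.H V where
  R := ρ.ρV
  f := τ.ω₀
  one_left := d.ω₀_one_left
  one_right := d.ω₀_one_right
  cocycle := d.ω₀_cocycle
  contMDiff_R := ρ.contMDiff_ρV
  contMDiff_f := τ.contMDiff_ω₀

/-- The cocycle of `G` with values in `W` underlying a 4-tuple. -/
def cocycleG (d : τ.IsExtensionData ρ) : GroupTwoCocycle X.𝔤 X.G W where
  R := ρ.ρW.comp X.i
  f := τ.ω₁
  one_left := d.ω₁_one_left
  one_right := d.ω₁_one_right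
  cocycle := d.ω₁_cocycle
  contMDiff_R := ρ.contMDiff_ρW.comp X.contMDiff_i
  contMDiff_f := τ.contMDiff_ω₁

variable (d : τ.IsExtensionData ρ)

theorem elH_mul (a : X.H) (u : V) (b : X.H) (v : V) : d.cocycleH.el a u * d.cocycleH.el b v =
    d.cocycleH.el (a * b) (u + ρ.ρV a v + τ.ω₀ a b) := rfl

theorem elG_mul (a : X.G) (u : W) (b : X.G) (v : W) : d.cocycleG.el a u * d.cocycleG.el b v =
    d.cocycleG.el (a * b) (u + ρ.ρW (X.i a) v + τ.ω₁ a b) := rfl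

/-- The structural map of the crossed module defined by a 4-tuple. -/
def map (p : d.cocycleG.Product) : d.cocycleH.Product :=
  d.cocycleH.el (X.i p.1) (φ p.2 + τ.χ p.1)

/-- The action of the crossed module defined by a 4-tuple. -/
def act (p : d.cocycleG.Product) (q : d.cocycleH.Product) : d.cocycleG.Product :=
  d.cocycleG.el (X.act p.1 q.1) (ρ.ρW q.1⁻¹ (p.2 + ρ.ρ₁ p.1 q.2) + τ.α q.1 p.1)

theorem map_el (g : X.G) (w : W) :
    d.map (d.cocycleG.el g w) = d.cocycleH.el (X.i g) (φ w + τ.χ g) := rfl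

theorem act_el (g : X.G) (w : W) (h : X.H) (v : V) :
    d.act (d.cocycleG.el g w) (d.cocycleH.el h v) =
      d.cocycleG.el (X.act g h) (ρ.ρW h⁻¹ (w + ρ.ρ₁ g v) + τ.α h g) := rfl

/-- As for the axioms below, the base component is the corresponding fact in X, and the fibre
component is one identity of the extension data, here `χ_mul`. -/
theorem map_mul (p q : d.cocycleG.Product) : d.map (p * q) = d.map p * d.map q := by
  obtain ⟨a, u⟩ := p
  obtain ⟨b, v⟩ := q
  change d.map (d.cocycleG.el a u * d.cocycleG.el b v) =
    d.map (d.cocycleG.el a u) * d.map (d.cocycleG.el b v)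
  rw [map_el, map_el, elG_mul, map_el, elH_mul, X.i.map_mul]
  congr 1
  simp only [map_add, ρ.comm]
  linear_combination (norm := abel) -(d.χ_mul a b)

theorem act_one (p : d.cocycleG.Product) : d.act p 1 = p := by
  obtain ⟨a, u⟩ := p
  change d.cocycleG.el (X.act a 1) (ρ.ρW 1⁻¹ (u + ρ.ρ₁ a 0) + τ.α 1 a) = d.cocycleG.el a u
  simp [X.act_one, d.α_one_left]

theorem act_mul (p : d.cocycleG.Product) (q r : d.cocycleH.Product) :
    d.act p (q * r) = d.act (d.act p q) r := by
  obtain ⟨g, w⟩ := p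
  obtain ⟨a, u⟩ := q
  obtain ⟨b, v⟩ := r
  change d.act (d.cocycleG.el g w) (d.cocycleH.el a u * d.cocycleH.el b v) =
    d.act (d.act (d.cocycleG.el g w) (d.cocycleH.el a u)) (d.cocycleH.el b v)
  rw [elH_mul, act_el, act_el, act_el, X.act_mul]
  congr 1
  have h := d.α_mul_left a b g
  simp only [mul_inv_rev, ρ.ρW_mul, map_add, ρ.map_act] at h ⊢
  linear_combination (norm := abel) h

theorem mul_act (p q : d.cocycleG.Product) (r : d.cocycleH.Product) :
    d.act (p * q) r = d.act p r * d.act q r := by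
  obtain ⟨a, u⟩ := p
  obtain ⟨b, v⟩ := q
  obtain ⟨h, x⟩ := r
  change d.act (d.cocycleG.el a u * d.cocycleG.el b v) (d.cocycleH.el h x) =
    d.act (d.cocycleG.el a u) (d.cocycleH.el h x) * d.act (d.cocycleG.el b v) (d.cocycleH.el h x)
  rw [elG_mul, act_el, act_el, act_el, elG_mul, X.mul_act]
  congr 1
  have h1 := d.α_mul_right h a b
  simp only [map_add, ρ.map_mul, X.i_act, ρ.ρW_mul, ρ.ρW_self_inv, ρ.map_i_W] at h1 ⊢
  linear_combination (norm := abel) h1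

/-- This axiom, like the Peiffer identity after it, is cleared of inverses, whose fibre components
are cumbersome in the twisted product. -/
theorem mul_map_act (p : d.cocycleG.Product) (q : d.cocycleH.Product) :
    q * d.map (d.act p q) = d.map p * q := by
  obtain ⟨g, w⟩ := p
  obtain ⟨h, v⟩ := q
  change d.cocycleH.el h v * d.map (d.act (d.cocycleG.el g w) (d.cocycleH.el h v)) =
    d.map (d.cocycleG.el g w) * d.cocycleH.el h v
  have e : h * X.i (X.act g h) = X.i g * h := by rw [X.i_act]; group
  rw [act_el, map_el, map_el, elH_mul, elH_mul, e]
  congr 1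
  have h1 := d.χ_act g h
  simp only [map_add, ρ.comm, ρ.ρV_self_inv, ρ.map_i_V] at h1 ⊢
  linear_combination (norm := abel) h1

theorem mul_act_map (p q : d.cocycleG.Product) : q * d.act p (d.map q) = p * q := by
  obtain ⟨f, w⟩ := p
  obtain ⟨g, u⟩ := q
  change d.cocycleG.el g u * d.act (d.cocycleG.el f w) (d.map (d.cocycleG.el g u)) =
    d.cocycleG.el f w * d.cocycleG.el g u
  have e : g * (g⁻¹ * f * g) = f * g := by group
  rw [map_el, act_el, elG_mul, elG_mul, X.peiffer, e]
  congr 1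
  have h1 := d.peiffer f g
  simp only [map_add, ρ.ρW_self_inv, ρ.map_i_W f] at h1 ⊢
  linear_combination (norm := abel) h1

theorem contMDiff_map : ContMDiff 𝓘(ℝ, X.𝔤 × W) 𝓘(ℝ, X.𝔥 × V) ∞ d.map :=
  GroupTwoCocycle.contMDiff_product_iff.2 ((X.contMDiff_i.comp d.cocycleG.contMDiff_fst).prodMk
    ((φ.contMDiff.comp d.cocycleG.contMDiff_snd).add
      (τ.contMDiff_χ.comp d.cocycleG.contMDiff_fst)))

theorem contMDiff_act : ContMDiff (𝓘(ℝ, X.𝔤 × W).prod 𝓘(ℝ, X.𝔥 × V)) 𝓘(ℝ, X.𝔤 × W) ∞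
    (fun p : d.cocycleG.Product × d.cocycleH.Product => d.act p.1 p.2) := by
  have hg := d.cocycleG.contMDiff_fst.comp (contMDiff_fst (I := 𝓘(ℝ, X.𝔤 × W))
    (J := 𝓘(ℝ, X.𝔥 × V)) (M := d.cocycleG.Product) (N := d.cocycleH.Product))
  have hw := d.cocycleG.contMDiff_snd.comp (contMDiff_fst (I := 𝓘(ℝ, X.𝔤 × W))
    (J := 𝓘(ℝ, X.𝔥 × V)) (M := d.cocycleG.Product) (N := d.cocycleH.Product))
  have hh := d.cocycleH.contMDiff_fst.comp (contMDiff_snd (I := 𝓘(ℝ, X.𝔤 × W))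
    (J := 𝓘(ℝ, X.𝔥 × V)) (M := d.cocycleG.Product) (N := d.cocycleH.Product))
  have hv := d.cocycleH.contMDiff_snd.comp (contMDiff_snd (I := 𝓘(ℝ, X.𝔤 × W))
    (J := 𝓘(ℝ, X.𝔥 × V)) (M := d.cocycleG.Product) (N := d.cocycleH.Product))
  exact GroupTwoCocycle.contMDiff_product_iff.2 ((X.contMDiff_act.comp (hg.prodMk hh)).prodMk
    (((ρ.contMDiff_ρW.comp hh.inv).clm_apply
      (hw.add ((ρ.contMDiff_ρ₁.comp hg).clm_apply hv))).add (τ.contMDiff_α.comp (hh.prodMk hg))))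

variable [FiniteDimensional ℝ W] [FiniteDimensional ℝ V]

/-- The Lie 2-group defined by a 4-tuple. -/
noncomputable def lieTwoGroup : LieTwoGroup.{u} where
  G := d.cocycleG.Product
  H := d.cocycleH.Product
  𝔤 := X.𝔤 × W
  𝔥 := X.𝔥 × V
  i := MonoidHom.mk' d.map d.map_mul
  act := d.act
  act_one := d.act_one
  act_mul := d.act_mul
  mul_act := d.mul_act
  i_act p q := by
    rw [mul_assoc, eq_inv_mul_iff_mul_eq]
    exact d.mul_map_act p q
  peiffer p q := by
    rw [mul_assoc, eq_inv_mul_iff_mul_eq]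
    exact d.mul_act_map p q
  contMDiff_i := d.contMDiff_map
  contMDiff_act := d.contMDiff_act

/-- The extension defined by a 4-tuple. -/
noncomputable def extension : Extension X φ where
  E := d.lieTwoGroup
  j₁ := d.cocycleG.el 1
  j₀ := d.cocycleH.el 1
  π₁ := MonoidHom.mk' (fun p : d.cocycleG.Product => p.1) fun _ _ => rfl
  π₀ := MonoidHom.mk' (fun p : d.cocycleH.Product => p.1) fun _ _ => rfl
  j₁_add w w' := by
    refine Eq.trans ?_ (d.elG_mul 1 w 1 w').symm
    simp [d.ω₁_one_left]; rfl
  j₀_add v v' := by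
    refine Eq.trans ?_ (d.elH_mul 1 v 1 v').symm
    simp [d.ω₀_one_left]; rfl
  isSmoothEmbedding_j₁ := d.cocycleG.isSmoothEmbedding_el_one
  isSmoothEmbedding_j₀ := d.cocycleH.isSmoothEmbedding_el_one
  contMDiff_π₁ := d.cocycleG.contMDiff_fst
  contMDiff_π₀ := d.cocycleH.contMDiff_fst
  exact₁ p := ⟨fun h => ⟨p.2, Prod.ext h.symm rfl⟩, by rintro ⟨w, rfl⟩; rfl⟩
  exact₀ p := ⟨fun h => ⟨p.2, Prod.ext h.symm rfl⟩, by rintro ⟨w, rfl⟩; rfl⟩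
  surjective_π₁ g := ⟨d.cocycleG.el g 0, rfl⟩
  surjective_π₀ h := ⟨d.cocycleH.el h 0, rfl⟩
  i_j w := by
    refine (d.map_el 1 w).trans ?_
    rw [map_one, d.χ_one, add_zero]
  act_j w v := by
    refine (d.act_el 1 w 1 v).trans ?_
    simp [X.act_one, d.α_one_left, ρ.ρ₁_one]
  i_π _ := rfl
  act_π _ _ := rfl

theorem defines_extension : τ.Defines ρ d.extension :=
  ⟨{ toFun := fun p => d.cocycleG.el p.1 p.2
     invFun := fun p : d.cocycleG.Product => (p.1, p.2)
     left_inv := fun _ => rfl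
     right_inv := fun _ => rfl
     contMDiff_toFun := GroupTwoCocycle.contMDiff_product_iff.2 contMDiff_id
     contMDiff_invFun := d.cocycleG.contMDiff_toProd },
   { toFun := fun p => d.cocycleH.el p.1 p.2
     invFun := fun p : d.cocycleH.Product => (p.1, p.2)
     left_inv := fun _ => rfl
     right_inv := fun _ => rfl
     contMDiff_toFun := GroupTwoCocycle.contMDiff_product_iff.2 contMDiff_id
     contMDiff_invFun := d.cocycleH.contMDiff_toProd },
   fun _ _ _ _ => rfl, fun _ _ _ _ => rfl, fun _ _ => rfl, fun _ _ _ _ => rfl, fun _ => rfl,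
   fun _ => rfl, fun _ _ => rfl, fun _ _ => rfl⟩

end FourTuple.IsExtensionData

/-- Recover the identities of extension data from an extension defined by a 4-tuple. -/
theorem FourTuple.Defines.isExtensionData {E : Extension X φ} (hE : τ.Defines ρ E) :
    τ.IsExtensionData ρ := by
  obtain ⟨Θ₁, Θ₀, m₀, m₁, hi, ha, hj₁, hj₀, -, -⟩ := hE
  have inj₀ {a b : X.H} {u v : V} (h : Θ₀ (a, u) = Θ₀ (b, v)) : u = v :=
    (Prod.ext_iff.1 (Θ₀.injective h)).2
  have inj₁ {a b : X.G} {u v : W} (h : Θ₁ (a, u) = Θ₁ (b, v)) : u = v :=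
    (Prod.ext_iff.1 (Θ₁.injective h)).2
  -- Each identity is an axiom of E evaluated on the zero section, where the linear terms vanish,
  -- and compared in the fibre component.
  have c₀ : ∀ a b c, ρ.ρV a (τ.ω₀ b c) + τ.ω₀ a (b * c) = τ.ω₀ (a * b) c + τ.ω₀ a b := by
    intro a b c
    have h := mul_assoc (Θ₀ (a, 0)) (Θ₀ (b, 0)) (Θ₀ (c, 0))
    simp only [m₀] at h
    have h := inj₀ h
    simp only [map_zero, zero_add, add_zero] at h
    linear_combination (norm := abel) -h
  have c₁ : ∀ a b c,
      ρ.ρW (X.i a) (τ.ω₁ b c) + τ.ω₁ a (b * c) = τ.ω₁ (a * b) c + τ.ω₁ a b := by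
    intro a b c
    have h := mul_assoc (Θ₁ (a, 0)) (Θ₁ (b, 0)) (Θ₁ (c, 0))
    simp only [m₁] at h
    have h := inj₁ h
    simp only [map_zero, zero_add, add_zero] at h
    linear_combination (norm := abel) -h
  -- Normalisation, not assumed of a 4-tuple, starts here: v ↦ (1, v) is additive, so (1, 0) is
  -- idempotent and hence the unit.
  have one₀ : Θ₀ (1, 0) = 1 := by
    have h := E.j₀_add 0 0
    rw [← hj₀]
    simpa using h
  have one₁ : Θ₁ (1, 0) = 1 := by
    have h := E.j₁_add 0 0
    rw [← hj₁]
    simpa using h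
  have oneα (g : X.G) : τ.α 1 g = 0 := by
    have h := E.E.act_one (Θ₁ (g, 0))
    rw [← one₀, ha] at h
    simpa using inj₁ h
  refine ⟨fun h => ?_, fun h => ?_, fun g => ?_, fun g => ?_, oneα, fun h => ?_, ?_, c₀, c₁,
    fun a b => ?_, fun a b g => ?_, fun h a b => ?_, fun g h => ?_, fun f g => ?_⟩
  · have e := one_mul (Θ₀ (h, 0))
    rw [← one₀, m₀] at e
    simpa using inj₀ e
  · have e := mul_one (Θ₀ (h, 0))
    rw [← one₀, m₀] at e
    simpa using inj₀ e
  · have e := one_mul (Θ₁ (g, 0))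
    rw [← one₁, m₁] at e
    simpa using inj₁ e
  · have e := mul_one (Θ₁ (g, 0))
    rw [← one₁, m₁] at e
    simpa using inj₁ e
  · have e := E.E.one_act (Θ₀ (h, 0))
    rw [← one₁, ha] at e
    simpa using inj₁ e
  · have e := E.E.i.map_one
    rw [← one₁, hi, ← one₀] at e
    simpa using inj₀ e
  · have e := E.E.i.map_mul (Θ₁ (a, 0)) (Θ₁ (b, 0))
    rw [m₁, hi, hi, hi, m₀] at e
    have e := inj₀ e
    simp only [map_zero, zero_add] at e
    linear_combination (norm := abel) -e
  · have e := E.E.act_mul (Θ₁ (g, 0)) (Θ₀ (a, 0)) (Θ₀ (b, 0))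
    rw [m₀, ha, ha, ha] at e
    have e := inj₁ e
    simp only [map_zero, zero_add, add_zero] at e
    linear_combination (norm := abel) e
  · have e := E.E.mul_act (Θ₁ (a, 0)) (Θ₁ (b, 0)) (Θ₀ (h, 0))
    rw [m₁, ha, ha, ha, m₁] at e
    have e := inj₁ e
    simp only [map_zero, zero_add, add_zero] at e
    linear_combination (norm := abel) e
  · have e := E.E.i_act (Θ₁ (g, 0)) (Θ₀ (h, 0))
    rw [mul_assoc, eq_inv_mul_iff_mul_eq, ha, hi, hi, m₀, m₀] at e
    have e := inj₀ e
    simp only [map_add, map_zero, zero_add, add_zero] at e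
    linear_combination (norm := abel) e
  · have e := E.E.peiffer (Θ₁ (f, 0)) (Θ₁ (g, 0))
    rw [mul_assoc, eq_inv_mul_iff_mul_eq, hi, ha, m₁, m₁, X.peiffer] at e
    have e := inj₁ e
    simp only [map_add, map_zero, zero_add, add_zero, ρ.ρW_self_inv] at e
    linear_combination (norm := abel) e

theorem FourTuple.exists_defines_iff [FiniteDimensional ℝ W] [FiniteDimensional ℝ V] :
    (∃ E : Extension X φ, τ.Defines ρ E) ↔ τ.toCochain ρ ∈ cocycles₂ ρ :=
  ⟨fun ⟨_, h⟩ => h.isExtensionData.toCochain_mem_cocycles₂,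
    fun h => ⟨_, (isExtensionData_of_mem_cocycles₂ h).defines_extension⟩⟩

end DefinedExtension

/-! ### Lifting smoothness through embeddings and to operators. -/

section Lifting

/-- For an immersion, smoothness after composition suffices once f is continuous; the topological
embedding supplies the continuity. -/
theorem Manifold.IsSmoothEmbedding.contMDiff_of_comp {𝕜 E₁ E₂ E₃ H₁ H₂ H₃ M N P : Type*}
    [NontriviallyNormedField 𝕜] [NormedAddCommGroup E₁] [NormedSpace 𝕜 E₁]
    [NormedAddCommGroup E₂] [NormedSpace 𝕜 E₂] [NormedAddCommGroup E₃] [NormedSpace 𝕜 E₃]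
    [TopologicalSpace H₁] [TopologicalSpace H₂] [TopologicalSpace H₃]
    {I₁ : ModelWithCorners 𝕜 E₁ H₁} {I₂ : ModelWithCorners 𝕜 E₂ H₂} {I₃ : ModelWithCorners 𝕜 E₃ H₃}
    [TopologicalSpace M] [ChartedSpace H₁ M] [TopologicalSpace N] [ChartedSpace H₂ N]
    [TopologicalSpace P] [ChartedSpace H₃ P] {n : ℕ∞ω}
    {j : N → P} (hj : IsSmoothEmbedding I₂ I₃ n j) {f : M → N} (hf : ContMDiff I₁ I₃ n (j ∘ f)) :
    ContMDiff I₁ I₂ n f :=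
  (ContMDiff.iff_comp_isImmersion hj.isImmersion).2
    ⟨hj.isEmbedding.continuous_iff.2 hf.continuous, hf⟩

/-- A map to continuous linear maps on a finite-dimensional space is smooth if it is so
pointwise. -/
theorem contMDiff_clm_of_apply {E H M V U : Type*} [NormedAddCommGroup E] [NormedSpace ℝ E]
    [TopologicalSpace H] {I : ModelWithCorners ℝ E H} [TopologicalSpace M] [ChartedSpace H M]
    [NormedAddCommGroup V] [NormedSpace ℝ V] [FiniteDimensional ℝ V]
    [NormedAddCommGroup U] [NormedSpace ℝ U] {n : ℕ∞ω}
    {A : M → (V →L[ℝ] U)} (hA : ∀ v, ContMDiff I 𝓘(ℝ, U) n (fun x => A x v)) :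
    ContMDiff I 𝓘(ℝ, V →L[ℝ] U) n A := by
  let b := Module.finBasis ℝ V
  -- In a basis b, A x is the sum of the rank-one operators built from the coordinate forms and the
  -- vectors A x (b k); each depends on its vector through a fixed continuous linear map.
  have h : A = fun x => ∑ k, ContinuousLinearMap.smulRightL ℝ V U
      (LinearMap.toContinuousLinearMap (b.coord k)) (A x (b k)) := by
    funext x
    ext v
    conv_lhs => rw [← b.sum_repr v, map_sum]
    simp
  rw [h]
  exact contMDiff_finsetSum fun k _ => (ContinuousLinearMap.contMDiff _).comp (hA (b k))

end Lifting

/-! ### The 2-representation induced by a split extension. -/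

theorem LieTwoGroup.inv_act (X : LieTwoGroup.{u}) (g : X.G) (h : X.H) :
    X.act g⁻¹ h = (X.act g h)⁻¹ := by
  rw [eq_inv_iff_mul_eq_one, ← X.mul_act, inv_mul_cancel, X.one_act]

namespace Extension

variable {X : LieTwoGroup.{u}} {W V : Type u}
  [NormedAddCommGroup W] [NormedSpace ℝ W] [NormedAddCommGroup V] [NormedSpace ℝ V]
  {φ : W →L[ℝ] V} (E : Extension X φ)

theorem j₀_zero : E.j₀ 0 = 1 := by simpa using E.j₀_add 0 0

theorem j₀_neg (v : V) : E.j₀ (-v) = (E.j₀ v)⁻¹ := by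
  rw [eq_inv_iff_mul_eq_one, ← E.j₀_add, neg_add_cancel, E.j₀_zero]

theorem j₀_injective : Function.Injective E.j₀ := E.isSmoothEmbedding_j₀.isEmbedding.injective

theorem j₁_injective : Function.Injective E.j₁ := E.isSmoothEmbedding_j₁.isEmbedding.injective

theorem π₀_j₀ (v : V) : E.π₀ (E.j₀ v) = 1 := (E.exact₀ _).2 ⟨v, rfl⟩

theorem π₁_j₁ (w : W) : E.π₁ (E.j₁ w) = 1 := (E.exact₁ _).2 ⟨w, rfl⟩

/-- The inverse of the inclusion `j₀` on the kernel of `π₀`. -/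
noncomputable def k₀ : E.E.H → V := Function.invFun E.j₀

/-- The inverse of the inclusion `j₁` on the kernel of `π₁`. -/
noncomputable def k₁ : E.E.G → W := Function.invFun E.j₁

variable {E} in
theorem j₀_k₀ {x : E.E.H} (hx : E.π₀ x = 1) : E.j₀ (E.k₀ x) = x :=
  Function.invFun_eq ((E.exact₀ x).1 hx)

variable {E} in
theorem j₁_k₁ {e : E.E.G} (he : E.π₁ e = 1) : E.j₁ (E.k₁ e) = e :=
  Function.invFun_eq ((E.exact₁ e).1 he)

section Smooth

variable {E} {A H M : Type*} [NormedAddCommGroup A] [NormedSpace ℝ A] [TopologicalSpace H]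
  {I : ModelWithCorners ℝ A H} [TopologicalSpace M] [ChartedSpace H M]

/-- Off the kernel of π₀ the values of `k₀` are arbitrary, so smoothness is stated along maps into
the kernel, where composing with j₀ gives the map back. -/
theorem contMDiff_k₀ {f : M → E.E.H} (hf : ContMDiff I 𝓘(ℝ, E.E.𝔥) ∞ f)
    (h : ∀ x, E.π₀ (f x) = 1) : ContMDiff I 𝓘(ℝ, V) ∞ (fun x => E.k₀ (f x)) := by
  refine E.isSmoothEmbedding_j₀.contMDiff_of_comp ?_
  have e : E.j₀ ∘ (fun x => E.k₀ (f x)) = f := funext fun x => j₀_k₀ (h x)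
  rwa [e]

theorem contMDiff_k₁ {f : M → E.E.G} (hf : ContMDiff I 𝓘(ℝ, E.E.𝔤) ∞ f)
    (h : ∀ x, E.π₁ (f x) = 1) : ContMDiff I 𝓘(ℝ, W) ∞ (fun x => E.k₁ (f x)) := by
  refine E.isSmoothEmbedding_j₁.contMDiff_of_comp ?_
  have e : E.j₁ ∘ (fun x => E.k₁ (f x)) = f := funext fun x => j₁_k₁ (h x)
  rwa [e]

theorem contMDiff_act {f : M → E.E.G} {g : M → E.E.H} (hf : ContMDiff I 𝓘(ℝ, E.E.𝔤) ∞ f)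
    (hg : ContMDiff I 𝓘(ℝ, E.E.𝔥) ∞ g) :
    ContMDiff I 𝓘(ℝ, E.E.𝔤) ∞ (fun x => E.E.act (f x) (g x)) :=
  E.E.contMDiff_act.comp (hf.prodMk hg)

end Smooth

theorem π₀_conj (x : E.E.H) (v : V) : E.π₀ (x * E.j₀ v * x⁻¹) = 1 := by
  simp [E.π₀_j₀]

theorem π₁_act_j₁ (x : E.E.H) (w : W) : E.π₁ (E.E.act (E.j₁ w) x) = 1 := by
  rw [E.act_π, E.π₁_j₁, X.one_act]

theorem π₁_act_j₀ (e : E.E.G) (v : V) : E.π₁ (E.E.act e (E.j₀ v) * e⁻¹) = 1 := by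
  rw [map_mul, E.act_π, E.π₀_j₀, X.act_one, map_inv, mul_inv_cancel]

theorem j₀_k₀_conj (x : E.E.H) (v : V) : E.j₀ (E.k₀ (x * E.j₀ v * x⁻¹)) = x * E.j₀ v * x⁻¹ :=
  j₀_k₀ (E.π₀_conj x v)

theorem j₁_k₁_act (x : E.E.H) (w : W) :
    E.j₁ (E.k₁ (E.E.act (E.j₁ w) x)) = E.E.act (E.j₁ w) x :=
  j₁_k₁ (E.π₁_act_j₁ x w)

theorem j₁_k₁_act_mul_inv (e : E.E.G) (v : V) :
    E.j₁ (E.k₁ (E.E.act e (E.j₀ v) * e⁻¹)) = E.E.act e (E.j₀ v) * e⁻¹ :=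
  j₁_k₁ (E.π₁_act_j₀ e v)

/-- Conjugation by an element of `E.H` on `V`. -/
noncomputable def conjV (x : E.E.H) : V →L[ℝ] V :=
  -- The group structure only yields additivity; real linearity follows from continuity. The same
  -- holds for the next two operators.
  AddMonoidHom.toRealLinearMap
    (AddMonoidHom.mk' (fun v => E.k₀ (x * E.j₀ v * x⁻¹)) fun v v' => E.j₀_injective (by
      simp only [E.j₀_k₀_conj]
      simp only [E.j₀_add, E.j₀_k₀_conj]
      group))
    (contMDiff_k₀ ((contMDiff_const.mul E.isSmoothEmbedding_j₀.contMDiff).mul contMDiff_const)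
      (E.π₀_conj x)).continuous

/-- The action of the inverse of an element of `E.H` on `W`. -/
noncomputable def actW (x : E.E.H) : W →L[ℝ] W :=
  AddMonoidHom.toRealLinearMap
    (AddMonoidHom.mk' (fun w => E.k₁ (E.E.act (E.j₁ w) x⁻¹)) fun w w' => E.j₁_injective (by
      simp only [E.j₁_k₁_act]
      simp only [E.j₁_add, E.j₁_k₁_act, E.E.mul_act]))
    (contMDiff_k₁ (contMDiff_act E.isSmoothEmbedding_j₁.contMDiff contMDiff_const)
      (E.π₁_act_j₁ x⁻¹)).continuous

/-- The map `v ↦ e ^ v * e⁻¹` for `e` in `E.G`. -/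
noncomputable def defect (e : E.E.G) : V →L[ℝ] W :=
  AddMonoidHom.toRealLinearMap
    (AddMonoidHom.mk' (fun v => E.k₁ (E.E.act e (E.j₀ v) * e⁻¹)) fun v v' => E.j₁_injective (by
      -- Acting by v and then v' gives (j₁(d v) e)^v' = j₁(d v) e^v', with d v the value at v,
      -- because V acts trivially on W.
      have h : E.E.act e (E.j₀ v) = E.j₁ (E.k₁ (E.E.act e (E.j₀ v) * e⁻¹)) * e := by
        rw [E.j₁_k₁_act_mul_inv, inv_mul_cancel_right]
      have h' := E.j₁_k₁_act_mul_inv e (v + v')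
      rw [h', E.j₁_add, E.j₀_add, E.E.act_mul, h, E.E.mul_act, E.act_j, ← h,
        E.j₁_k₁_act_mul_inv e v', mul_assoc]))
    (contMDiff_k₁ ((contMDiff_act contMDiff_const E.isSmoothEmbedding_j₀.contMDiff).mul
      contMDiff_const) (E.π₁_act_j₀ e)).continuous

theorem j₀_conjV (x : E.E.H) (v : V) : E.j₀ (E.conjV x v) = x * E.j₀ v * x⁻¹ := E.j₀_k₀_conj x v

theorem j₁_actW (x : E.E.H) (w : W) : E.j₁ (E.actW x w) = E.E.act (E.j₁ w) x⁻¹ :=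
  E.j₁_k₁_act x⁻¹ w

theorem j₁_defect (e : E.E.G) (v : V) : E.j₁ (E.defect e v) = E.E.act e (E.j₀ v) * e⁻¹ :=
  E.j₁_k₁_act_mul_inv e v

theorem mul_j₀ (x : E.E.H) (v : V) : x * E.j₀ v = E.j₀ (E.conjV x v) * x := by
  rw [E.j₀_conjV, inv_mul_cancel_right]

theorem act_j₁ (x : E.E.H) (w : W) : E.E.act (E.j₁ w) x = E.j₁ (E.actW x⁻¹ w) := by
  rw [E.j₁_actW, inv_inv]

theorem act_j₀ (e : E.E.G) (v : V) : E.E.act e (E.j₀ v) = E.j₁ (E.defect e v) * e := by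
  rw [E.j₁_defect, inv_mul_cancel_right]

/-- By the Peiffer identity, conjugation by e on W is the action of the inverse of its image in
`E.H`. -/
theorem mul_j₁ (e : E.E.G) (w : W) : e * E.j₁ w = E.j₁ (E.actW (E.E.i e) w) * e := by
  rw [E.j₁_actW, ← map_inv, E.E.peiffer]
  group

/-- V is abelian, so a factor from V does not affect conjugation on V. With the next two lemmas,
which use the trivial action of V on W and commutativity of W, this makes the three operators depend
only on projections to X. -/
theorem conjV_j₀_mul (v : V) (x : E.E.H) : E.conjV (E.j₀ v * x) = E.conjV x := by
  ext u
  apply E.j₀_injective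
  have h : E.j₀ v * E.j₀ (E.conjV x u) = E.j₀ (E.conjV x u) * E.j₀ v := by
    rw [← E.j₀_add, ← E.j₀_add, add_comm]
  rw [E.j₀_conjV, mul_assoc (E.j₀ v), E.mul_j₀, ← mul_assoc, h]
  group

theorem actW_j₀_mul (v : V) (x : E.E.H) : E.actW (E.j₀ v * x) = E.actW x := by
  ext w
  apply E.j₁_injective
  rw [E.j₁_actW, mul_inv_rev, E.E.act_mul, ← E.j₁_actW, ← E.j₀_neg, E.act_j]

theorem defect_j₁_mul (w : W) (e : E.E.G) : E.defect (E.j₁ w * e) = E.defect e := by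
  ext v
  apply E.j₁_injective
  have h : E.j₁ w * E.j₁ (E.defect e v) = E.j₁ (E.defect e v) * E.j₁ w := by
    rw [← E.j₁_add, ← E.j₁_add, add_comm]
  rw [E.j₁_defect, E.E.mul_act, E.act_j, E.act_j₀, ← mul_assoc, h]
  group

variable {E} in
theorem exists_eq_j₀_mul {x y : E.E.H} (h : E.π₀ x = E.π₀ y) : ∃ v, x = E.j₀ v * y := by
  have h' : E.π₀ (x * y⁻¹) = 1 := by rw [map_mul, map_inv, h, mul_inv_cancel]
  exact ⟨E.k₀ (x * y⁻¹), by rw [j₀_k₀ h', inv_mul_cancel_right]⟩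

variable {E} in
theorem exists_eq_j₁_mul {e f : E.E.G} (h : E.π₁ e = E.π₁ f) : ∃ w, e = E.j₁ w * f := by
  have h' : E.π₁ (e * f⁻¹) = 1 := by rw [map_mul, map_inv, h, mul_inv_cancel]
  exact ⟨E.k₁ (e * f⁻¹), by rw [j₁_k₁ h', inv_mul_cancel_right]⟩

variable {E} in
theorem conjV_congr {x y : E.E.H} (h : E.π₀ x = E.π₀ y) : E.conjV x = E.conjV y := by
  obtain ⟨v, rfl⟩ := exists_eq_j₀_mul h
  exact E.conjV_j₀_mul v y

variable {E} in
theorem actW_congr {x y : E.E.H} (h : E.π₀ x = E.π₀ y) : E.actW x = E.actW y := by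
  obtain ⟨v, rfl⟩ := exists_eq_j₀_mul h
  exact E.actW_j₀_mul v y

variable {E} in
theorem defect_congr {e f : E.E.G} (h : E.π₁ e = E.π₁ f) : E.defect e = E.defect f := by
  obtain ⟨w, rfl⟩ := exists_eq_j₁_mul h
  exact E.defect_j₁_mul w f

theorem conjV_one : E.conjV 1 = 1 := by
  ext v
  apply E.j₀_injective
  simp [E.j₀_conjV]

theorem conjV_mul (x y : E.E.H) : E.conjV (x * y) = E.conjV x * E.conjV y := by
  ext v
  apply E.j₀_injective
  change E.j₀ (E.conjV (x * y) v) = E.j₀ (E.conjV x (E.conjV y v))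
  simp only [E.j₀_conjV]
  group

theorem actW_one : E.actW 1 = 1 := by
  ext w
  apply E.j₁_injective
  simp [E.j₁_actW, E.E.act_one]

theorem actW_mul (x y : E.E.H) : E.actW (x * y) = E.actW x * E.actW y := by
  ext w
  apply E.j₁_injective
  change E.j₁ (E.actW (x * y) w) = E.j₁ (E.actW x (E.actW y w))
  rw [E.j₁_actW, E.j₁_actW, E.j₁_actW, mul_inv_rev, E.E.act_mul]

/-- The 2-representation `ρ` describes the conjugations and actions in the extension `E`. -/
structure IsInduced (ρ : TwoRep X φ) : Prop where
  ρV_eq : ∀ x, ρ.ρV (E.π₀ x) = E.conjV x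
  ρW_eq : ∀ x, ρ.ρW (E.π₀ x) = E.actW x
  ρ₁_eq : ∀ e, ρ.ρ₁ (E.π₁ e) = E.defect e

variable {E} in
-- The right side does not mention σ: this is the independence of the splitting.
theorem Splitting.induces_iff (σ : E.Splitting) {ρ : TwoRep X φ} :
    σ.Induces ρ ↔ E.IsInduced ρ := by
  constructor
  · rintro ⟨h1, h2, h3⟩
    refine ⟨fun x => ?_, fun x => ?_, fun e => ?_⟩
    · rw [← conjV_congr (σ.π_σ₀ (E.π₀ x))]
      ext v
      exact E.j₀_injective ((h1 _ v).trans (E.j₀_conjV _ v).symm)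
    · rw [← actW_congr (σ.π_σ₀ (E.π₀ x))]
      ext w
      exact E.j₁_injective ((h2 _ w).trans (E.j₁_actW _ w).symm)
    · rw [← defect_congr (σ.π_σ₁ (E.π₁ e))]
      ext v
      exact E.j₁_injective ((h3 _ v).trans (E.j₁_defect _ v).symm)
  · rintro ⟨h1, h2, h3⟩
    refine ⟨fun h v => ?_, fun h w => ?_, fun g v => ?_⟩
    · rw [← E.j₀_conjV, ← h1, σ.π_σ₀]
    · rw [← E.j₁_actW, ← h2, σ.π_σ₀]
    · rw [← E.j₁_defect, ← h3, σ.π_σ₁]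

variable {E} in
theorem IsInduced.unique {ρ ρ' : TwoRep X φ} (h : E.IsInduced ρ) (h' : E.IsInduced ρ') :
    ρ = ρ' := by
  refine TwoRep.ext (MonoidHom.ext fun a => ?_) (MonoidHom.ext fun a => ?_) (funext fun g => ?_)
  · obtain ⟨x, rfl⟩ := E.surjective_π₀ a
    rw [h.ρW_eq, h'.ρW_eq]
  · obtain ⟨x, rfl⟩ := E.surjective_π₀ a
    rw [h.ρV_eq, h'.ρV_eq]
  · obtain ⟨e, rfl⟩ := E.surjective_π₁ g
    rw [h.ρ₁_eq, h'.ρ₁_eq]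

/-- From here to `defect_act`, the axioms of a 2-representation are proved for operators indexed by
E itself, where they follow from the crossed module axioms of E. -/
theorem map_actW (x : E.E.H) (w : W) : φ (E.actW x w) = E.conjV x (φ w) := by
  apply E.j₀_injective
  rw [← E.i_j, E.j₁_actW, E.E.i_act, E.i_j, E.j₀_conjV, inv_inv]

theorem actW_i (e : E.E.G) (w : W) : E.actW (E.E.i e) w = w + E.defect e (φ w) := by
  apply E.j₁_injective
  rw [E.j₁_add, E.j₁_defect, ← E.i_j, E.E.peiffer, eq_comm, ← mul_assoc, ← mul_assoc,
    mul_inv_cancel_left, E.mul_j₁, mul_inv_cancel_right]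

theorem conjV_i (e : E.E.G) (v : V) : E.conjV (E.E.i e) v = v + φ (E.defect e v) := by
  apply E.j₀_injective
  rw [E.j₀_add, ← E.i_j, E.j₁_defect, map_mul, E.E.i_act, E.j₀_conjV, map_inv]
  group

theorem defect_mul (e f : E.E.G) (v : V) :
    E.defect (e * f) v = E.defect e v + E.defect f v + E.defect e (φ (E.defect f v)) := by
  rw [add_assoc, ← E.actW_i]
  apply E.j₁_injective
  have h : E.j₁ (E.actW (E.E.i e) (E.defect f v)) = e * E.j₁ (E.defect f v) * e⁻¹ := by
    rw [E.mul_j₁, mul_inv_cancel_right]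
  rw [E.j₁_add, E.j₁_defect, E.E.mul_act, E.act_j₀ e, E.act_j₀ f, h]
  group

theorem defect_act (e : E.E.G) (x : E.E.H) (v : V) :
    E.defect (E.E.act e x) v = E.actW x⁻¹ (E.defect e (E.conjV x v)) := by
  apply E.j₁_injective
  rw [E.j₁_defect, E.j₁_actW, E.j₁_defect, inv_inv, E.E.mul_act, ← E.E.act_mul, ← E.E.act_mul,
    ← E.mul_j₀, E.E.inv_act]

/-- Since the operators depend only on projections, each axiom can be checked at arbitrary lifts to
E instead of at values of σ. The smooth sections then make the operators smooth in h and g. -/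
theorem Splitting.exists_isInduced [FiniteDimensional ℝ W] [FiniteDimensional ℝ V]
    {E : Extension X φ} (σ : E.Splitting) : ∃ ρ : TwoRep X φ, E.IsInduced ρ := by
  have hV (x : E.E.H) : E.conjV (σ.σ₀ (E.π₀ x)) = E.conjV x := conjV_congr (σ.π_σ₀ _)
  have hW (x : E.E.H) : E.actW (σ.σ₀ (E.π₀ x)) = E.actW x := actW_congr (σ.π_σ₀ _)
  have h1 (e : E.E.G) : E.defect (σ.σ₁ (E.π₁ e)) = E.defect e := defect_congr (σ.π_σ₁ _)
  refine ⟨{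
    ρW := { toFun := fun h => E.actW (σ.σ₀ h), map_one' := ?_, map_mul' := ?_ }
    ρV := { toFun := fun h => E.conjV (σ.σ₀ h), map_one' := ?_, map_mul' := ?_ }
    ρ₁ := fun g => E.defect (σ.σ₁ g)
    comm := fun h w => E.map_actW _ w
    map_mul := ?_
    map_i_W := ?_
    map_i_V := ?_
    map_act := ?_
    contMDiff_ρW := ?_
    contMDiff_ρV := ?_
    contMDiff_ρ₁ := ?_ }, hV, hW, h1⟩
  · rw [← E.π₀.map_one, hW, E.actW_one]
  · intro a b
    obtain ⟨x, rfl⟩ := E.surjective_π₀ a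
    obtain ⟨y, rfl⟩ := E.surjective_π₀ b
    rw [← map_mul, hW, hW, hW, E.actW_mul]
  · rw [← E.π₀.map_one, hV, E.conjV_one]
  · intro a b
    obtain ⟨x, rfl⟩ := E.surjective_π₀ a
    obtain ⟨y, rfl⟩ := E.surjective_π₀ b
    rw [← map_mul, hV, hV, hV, E.conjV_mul]
  · intro a b v
    obtain ⟨e, rfl⟩ := E.surjective_π₁ a
    obtain ⟨f, rfl⟩ := E.surjective_π₁ b
    rw [← map_mul, h1, h1, h1, E.defect_mul]
  · intro a w
    obtain ⟨e, rfl⟩ := E.surjective_π₁ a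
    change E.actW (σ.σ₀ (X.i (E.π₁ e))) w = _
    rw [E.i_π, hW, h1, E.actW_i]
  · intro a w
    obtain ⟨e, rfl⟩ := E.surjective_π₁ a
    change E.conjV (σ.σ₀ (X.i (E.π₁ e))) w = _
    rw [E.i_π, hV, h1, E.conjV_i]
  · intro a b v
    obtain ⟨e, rfl⟩ := E.surjective_π₁ a
    obtain ⟨x, rfl⟩ := E.surjective_π₀ b
    change _ = E.actW (σ.σ₀ (E.π₀ x)⁻¹) (E.defect _ (E.conjV (σ.σ₀ (E.π₀ x)) v))
    rw [← E.act_π, ← map_inv, hW, hV, h1, h1, E.defect_act]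
  · exact contMDiff_clm_of_apply fun w =>
      contMDiff_k₁ (contMDiff_act contMDiff_const σ.contMDiff_σ₀.inv) fun h => E.π₁_act_j₁ _ w
  · exact contMDiff_clm_of_apply fun v =>
      contMDiff_k₀ ((σ.contMDiff_σ₀.mul contMDiff_const).mul σ.contMDiff_σ₀.inv)
        fun h => E.π₀_conj _ v
  · exact contMDiff_clm_of_apply fun v =>
      contMDiff_k₁ ((contMDiff_act σ.contMDiff_σ₁ contMDiff_const).mul σ.contMDiff_σ₁.inv)
        fun h => E.π₁_act_j₀ _ v

theorem existsUnique_induces [FiniteDimensional ℝ W] [FiniteDimensional ℝ V]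
    {E : Extension X φ} (hE : Nonempty E.Splitting) :
    ∃! ρ : TwoRep X φ, ∀ σ : E.Splitting, σ.Induces ρ := by
  obtain ⟨σ⟩ := hE
  obtain ⟨ρ, hρ⟩ := σ.exists_isInduced
  exact ⟨ρ, fun σ' => σ'.induces_iff.2 hρ, fun ρ' h => (σ.induces_iff.1 (h σ)).unique hρ⟩

theorem IsEquivalent.exists_induces {E F : Extension X φ} (h : E.IsEquivalent F) {ρ : TwoRep X φ}
    (hE : ∃ σ : E.Splitting, σ.Induces ρ) : ∃ σ : F.Splitting, σ.Induces ρ := by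
  obtain ⟨σ, h1, h2, h3⟩ := hE
  obtain ⟨a, b, ⟨s1, -⟩, ⟨s2, -⟩, -, ha, hj₁, hj₀, hπ₁, hπ₀⟩ := h
  refine ⟨⟨fun g => a (σ.σ₁ g), fun h => b (σ.σ₀ h), s1.comp σ.contMDiff_σ₁,
    s2.comp σ.contMDiff_σ₀, fun g => by rw [hπ₁, σ.π_σ₁], fun h => by rw [hπ₀, σ.π_σ₀]⟩,
    fun h v => ?_, fun h w => ?_, fun g v => ?_⟩
  · simp only [← hj₀, h1, map_mul, map_inv]
  · simp only [← hj₁, h2, ha, map_inv]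
  · simp only [← hj₁, ← hj₀, h3, ha, map_mul, map_inv]

end Extension

/-! ### The 4-tuple of a normalised splitting. -/

namespace Extension

variable {X : LieTwoGroup.{u}} {W V : Type u}
  [NormedAddCommGroup W] [NormedSpace ℝ W] [NormedAddCommGroup V] [NormedSpace ℝ V]
  {φ : W →L[ℝ] V} {E : Extension X φ}

/-- A splitting can be normalised so that both sections preserve the identity. -/
theorem Splitting.exists_normalised (σ : E.Splitting) :
    ∃ s : E.Splitting, s.σ₁ 1 = 1 ∧ s.σ₀ 1 = 1 := by
  refine ⟨⟨fun g => (σ.σ₁ 1)⁻¹ * σ.σ₁ g, fun h => (σ.σ₀ 1)⁻¹ * σ.σ₀ h,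
    contMDiff_const.mul σ.contMDiff_σ₁, contMDiff_const.mul σ.contMDiff_σ₀,
    fun g => ?_, fun h => ?_⟩, inv_mul_cancel _, inv_mul_cancel _⟩
  · rw [map_mul, map_inv, σ.π_σ₁, σ.π_σ₁, inv_one, one_mul]
  · rw [map_mul, map_inv, σ.π_σ₀, σ.π_σ₀, inv_one, one_mul]

namespace Splitting

variable (s : E.Splitting)

theorem π₀_mul_inv (x : E.E.H) : E.π₀ (x * (s.σ₀ (E.π₀ x))⁻¹) = 1 := by
  rw [map_mul, map_inv, s.π_σ₀, mul_inv_cancel]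

theorem π₁_mul_inv (e : E.E.G) : E.π₁ (e * (s.σ₁ (E.π₁ e))⁻¹) = 1 := by
  rw [map_mul, map_inv, s.π_σ₁, mul_inv_cancel]

/-- The component in `V` of an element of `E.H`. -/
noncomputable def c₀ (x : E.E.H) : V := E.k₀ (x * (s.σ₀ (E.π₀ x))⁻¹)

/-- The component in `W` of an element of `E.G`. -/
noncomputable def c₁ (e : E.E.G) : W := E.k₁ (e * (s.σ₁ (E.π₁ e))⁻¹)

theorem j₀_c₀_mul (x : E.E.H) : E.j₀ (s.c₀ x) * s.σ₀ (E.π₀ x) = x := by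
  rw [c₀, j₀_k₀ (s.π₀_mul_inv x), inv_mul_cancel_right]

theorem j₁_c₁_mul (e : E.E.G) : E.j₁ (s.c₁ e) * s.σ₁ (E.π₁ e) = e := by
  rw [c₁, j₁_k₁ (s.π₁_mul_inv e), inv_mul_cancel_right]

theorem π₀_j₀_mul (v : V) (h : X.H) : E.π₀ (E.j₀ v * s.σ₀ h) = h := by
  rw [map_mul, E.π₀_j₀, s.π_σ₀, one_mul]

theorem π₁_j₁_mul (w : W) (g : X.G) : E.π₁ (E.j₁ w * s.σ₁ g) = g := by
  rw [map_mul, E.π₁_j₁, s.π_σ₁, one_mul]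

theorem c₀_j₀_mul (v : V) (h : X.H) : s.c₀ (E.j₀ v * s.σ₀ h) = v := by
  apply E.j₀_injective
  have e := s.j₀_c₀_mul (E.j₀ v * s.σ₀ h)
  rw [π₀_j₀_mul] at e
  exact mul_right_cancel e

theorem c₁_j₁_mul (w : W) (g : X.G) : s.c₁ (E.j₁ w * s.σ₁ g) = w := by
  apply E.j₁_injective
  have e := s.j₁_c₁_mul (E.j₁ w * s.σ₁ g)
  rw [π₁_j₁_mul] at e
  exact mul_right_cancel e

theorem contMDiff_c₀ : ContMDiff 𝓘(ℝ, E.E.𝔥) 𝓘(ℝ, V) ∞ s.c₀ :=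
  contMDiff_k₀ (contMDiff_id.mul (s.contMDiff_σ₀.comp E.contMDiff_π₀).inv) s.π₀_mul_inv

theorem contMDiff_c₁ : ContMDiff 𝓘(ℝ, E.E.𝔤) 𝓘(ℝ, W) ∞ s.c₁ :=
  contMDiff_k₁ (contMDiff_id.mul (s.contMDiff_σ₁.comp E.contMDiff_π₁).inv) s.π₁_mul_inv

/-- The trivialisation `H × V → E.H` given by a splitting. -/
noncomputable def diffeo₀ :
    Diffeomorph (𝓘(ℝ, X.𝔥).prod 𝓘(ℝ, V)) 𝓘(ℝ, E.E.𝔥) (X.H × V) E.E.H ∞ where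
  toFun p := E.j₀ p.2 * s.σ₀ p.1
  invFun x := (E.π₀ x, s.c₀ x)
  left_inv p := Prod.ext (s.π₀_j₀_mul p.2 p.1) (s.c₀_j₀_mul p.2 p.1)
  right_inv := s.j₀_c₀_mul
  contMDiff_toFun := (E.isSmoothEmbedding_j₀.contMDiff.comp contMDiff_snd).mul
    (s.contMDiff_σ₀.comp contMDiff_fst)
  contMDiff_invFun := E.contMDiff_π₀.prodMk s.contMDiff_c₀

/-- The trivialisation `G × W → E.G` given by a splitting. -/
noncomputable def diffeo₁ :
    Diffeomorph (𝓘(ℝ, X.𝔤).prod 𝓘(ℝ, W)) 𝓘(ℝ, E.E.𝔤) (X.G × W) E.E.G ∞ where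
  toFun p := E.j₁ p.2 * s.σ₁ p.1
  invFun x := (E.π₁ x, s.c₁ x)
  left_inv p := Prod.ext (s.π₁_j₁_mul p.2 p.1) (s.c₁_j₁_mul p.2 p.1)
  right_inv := s.j₁_c₁_mul
  contMDiff_toFun := (E.isSmoothEmbedding_j₁.contMDiff.comp contMDiff_snd).mul
    (s.contMDiff_σ₁.comp contMDiff_fst)
  contMDiff_invFun := E.contMDiff_π₁.prodMk s.contMDiff_c₁

/-- The 4-tuple given by a splitting. -/
noncomputable def fourTuple : FourTuple X W V where
  ω₀ a b := s.c₀ (s.σ₀ a * s.σ₀ b)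
  ω₁ a b := s.c₁ (s.σ₁ a * s.σ₁ b)
  α h g := s.c₁ (E.E.act (s.σ₁ g) (s.σ₀ h))
  χ g := s.c₀ (E.E.i (s.σ₁ g))
  contMDiff_ω₀ := s.contMDiff_c₀.comp
    ((s.contMDiff_σ₀.comp contMDiff_fst).mul (s.contMDiff_σ₀.comp contMDiff_snd))
  contMDiff_ω₁ := s.contMDiff_c₁.comp
    ((s.contMDiff_σ₁.comp contMDiff_fst).mul (s.contMDiff_σ₁.comp contMDiff_snd))
  contMDiff_α := s.contMDiff_c₁.comp
    (contMDiff_act (s.contMDiff_σ₁.comp contMDiff_snd) (s.contMDiff_σ₀.comp contMDiff_fst))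
  contMDiff_χ := s.contMDiff_c₀.comp (E.E.contMDiff_i.comp s.contMDiff_σ₁)

/-- Each formula arises by moving fibre elements to the left past section elements: ρ records the
change, and the components c₀, c₁ record the remainder. Normalisation of the sections makes the
inclusions v ↦ (1, v) and w ↦ (1, w). -/
theorem fourTuple_defines {ρ : TwoRep X φ} (hρ : E.IsInduced ρ) (h₁ : s.σ₁ 1 = 1)
    (h₀ : s.σ₀ 1 = 1) : s.fourTuple.Defines ρ E := by
  refine ⟨s.diffeo₁, s.diffeo₀, fun a u b v => ?_, fun a u b v => ?_, fun g w => ?_,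
    fun g w h v => ?_, fun w => ?_, fun v => ?_, fun g w => s.π₁_j₁_mul w g,
    fun h v => s.π₀_j₀_mul v h⟩
  · change E.j₀ u * s.σ₀ a * (E.j₀ v * s.σ₀ b) =
      E.j₀ (u + ρ.ρV a v + s.c₀ (s.σ₀ a * s.σ₀ b)) * s.σ₀ (a * b)
    have e := s.j₀_c₀_mul (s.σ₀ a * s.σ₀ b)
    have r := hρ.ρV_eq (s.σ₀ a)
    rw [map_mul, s.π_σ₀, s.π_σ₀] at e
    rw [s.π_σ₀] at r
    rw [E.j₀_add, mul_assoc _ (E.j₀ (s.c₀ _)), e, E.j₀_add, r, mul_assoc (E.j₀ u),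
      ← mul_assoc (s.σ₀ a), E.mul_j₀]
    simp only [mul_assoc]
  · change E.j₁ u * s.σ₁ a * (E.j₁ v * s.σ₁ b) =
      E.j₁ (u + ρ.ρW (X.i a) v + s.c₁ (s.σ₁ a * s.σ₁ b)) * s.σ₁ (a * b)
    have e := s.j₁_c₁_mul (s.σ₁ a * s.σ₁ b)
    have r := hρ.ρW_eq (E.E.i (s.σ₁ a))
    rw [map_mul, s.π_σ₁, s.π_σ₁] at e
    rw [← E.i_π, s.π_σ₁] at r
    rw [E.j₁_add, mul_assoc _ (E.j₁ (s.c₁ _)), e, E.j₁_add, r, mul_assoc (E.j₁ u),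
      ← mul_assoc (s.σ₁ a), E.mul_j₁]
    simp only [mul_assoc]
  · change E.E.i (E.j₁ w * s.σ₁ g) = E.j₀ (φ w + s.c₀ (E.E.i (s.σ₁ g))) * s.σ₀ (X.i g)
    have e := s.j₀_c₀_mul (E.E.i (s.σ₁ g))
    rw [← E.i_π, s.π_σ₁] at e
    rw [E.j₀_add, mul_assoc, e, map_mul, E.i_j]
  · change E.E.act (E.j₁ w * s.σ₁ g) (E.j₀ v * s.σ₀ h) =
      E.j₁ (ρ.ρW h⁻¹ (w + ρ.ρ₁ g v) + s.c₁ (E.E.act (s.σ₁ g) (s.σ₀ h))) * s.σ₁ (X.act g h)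
    have e := s.j₁_c₁_mul (E.E.act (s.σ₁ g) (s.σ₀ h))
    have r := hρ.ρW_eq (s.σ₀ h)⁻¹
    have r' := hρ.ρ₁_eq (s.σ₁ g)
    rw [E.act_π, s.π_σ₀, s.π_σ₁] at e
    rw [map_inv, s.π_σ₀] at r
    rw [s.π_σ₁] at r'
    rw [E.j₁_add, mul_assoc, e, r, ← E.act_j₁, E.j₁_add, ← E.E.mul_act, E.E.act_mul,
      E.E.mul_act (E.j₁ w), E.act_j, E.act_j₀, r', mul_assoc]
  · change E.j₁ w = E.j₁ w * s.σ₁ 1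
    rw [h₁, mul_one]
  · change E.j₀ v = E.j₀ v * s.σ₀ 1
    rw [h₀, mul_one]

end Splitting

theorem exists_defines {ρ : TwoRep X φ} (hE : ∃ σ : E.Splitting, σ.Induces ρ) :
    ∃ τ : FourTuple X W V, τ.Defines ρ E := by
  obtain ⟨σ, hσ⟩ := hE
  obtain ⟨s, h₁, h₀⟩ := σ.exists_normalised
  exact ⟨_, s.fourTuple_defines (σ.induces_iff.1 hσ) h₁ h₀⟩

end Extension

/-! ### Equivalences of extensions as coboundaries. -/

theorem Diffeomorph.exists_mk_eq {𝕜 E₁ E₂ H₁ H₂ A B N : Type*} [NontriviallyNormedField 𝕜]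
    [NormedAddCommGroup E₁] [NormedSpace 𝕜 E₁] [NormedAddCommGroup E₂] [NormedSpace 𝕜 E₂]
    [TopologicalSpace H₁] [TopologicalSpace H₂]
    {I₁ : ModelWithCorners 𝕜 E₁ H₁} {I₂ : ModelWithCorners 𝕜 E₂ H₂}
    [TopologicalSpace A] [TopologicalSpace B] [ChartedSpace H₁ (A × B)]
    [TopologicalSpace N] [ChartedSpace H₂ N] {n : ℕ∞ω}
    (Θ : Diffeomorph I₁ I₂ (A × B) N n) (x : N) : ∃ a b, Θ (a, b) = x :=
  ⟨(Θ.symm x).1, (Θ.symm x).2, Θ.apply_symm_apply x⟩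

namespace FourTuple

variable {X : LieTwoGroup.{u}} {W V : Type u}
  [NormedAddCommGroup W] [NormedSpace ℝ W] [NormedAddCommGroup V] [NormedSpace ℝ V]
  {φ : W →L[ℝ] V} {ρ : TwoRep X φ} {τ τ' : FourTuple X W V} {E E' : Extension X φ}

/-- The zero sections h ↦ (h, 0) and g ↦ (g, 0) form a splitting that induces ρ. -/
theorem Defines.exists_induces (h : τ.Defines ρ E) : ∃ σ : E.Splitting, σ.Induces ρ := by
  have d := h.isExtensionData
  obtain ⟨Θ₁, Θ₀, m₀, m₁, hi, ha, hj₁, hj₀, hπ₁, hπ₀⟩ := h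
  refine ⟨⟨fun g => Θ₁ (g, 0), fun h => Θ₀ (h, 0),
    Θ₁.contMDiff.comp (contMDiff_id.prodMk contMDiff_const),
    Θ₀.contMDiff.comp (contMDiff_id.prodMk contMDiff_const), fun g => hπ₁ g 0, fun h => hπ₀ h 0⟩,
    fun h v => ?_, fun h w => ?_, fun g v => ?_⟩
  · rw [eq_mul_inv_iff_mul_eq, hj₀, hj₀, m₀, m₀]
    simp [d.ω₀_one_left, d.ω₀_one_right]
  · have e : E.E.act (E.j₁ (ρ.ρW h w)) (Θ₀ (h, 0)) = E.j₁ w := by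
      rw [hj₁, hj₁, ha, X.one_act, d.α_one_right, map_zero, add_zero, add_zero, ρ.ρW_inv_self]
    change _ = E.E.act (E.j₁ w) (Θ₀ (h, 0))⁻¹
    rw [← e, ← E.E.act_mul, mul_inv_cancel, E.E.act_one]
  · rw [eq_mul_inv_iff_mul_eq, hj₁, hj₀, ha, m₁]
    simp [d.ω₁_one_left, d.α_one_left, X.act_one]

/-- The two 4-tuples differ by the coboundary of `(lam₀, lam₁, 0)`. -/
structure IsCobounded (ρ : TwoRep X φ) (τ τ' : FourTuple X W V) (lam₀ : X.H → V)
    (lam₁ : X.G → W) : Prop where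
  ω₀_add : ∀ a b, lam₀ (a * b) + τ.ω₀ a b = lam₀ a + ρ.ρV a (lam₀ b) + τ'.ω₀ a b
  ω₁_add : ∀ a b, lam₁ (a * b) + τ.ω₁ a b = lam₁ a + ρ.ρW (X.i a) (lam₁ b) + τ'.ω₁ a b
  α_add : ∀ h g, lam₁ (X.act g h) + τ.α h g =
    ρ.ρW h⁻¹ (lam₁ g + ρ.ρ₁ g (lam₀ h)) + τ'.α h g
  χ_add : ∀ g, lam₀ (X.i g) + τ.χ g = φ (lam₁ g) + τ'.χ g

/-- Attached cochains have last component 0, which forces v = 0. The arrow component, taken at h =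
1, gives the condition on χ; conversely that condition, translated by ρ(h) and combined with the one
on ω₀, gives it for all h. -/
theorem sub_mem_coboundaries₂_iff : τ.toCochain ρ - τ'.toCochain ρ ∈ coboundaries₂ ρ ↔
    ∃ lam₀ lam₁, ContMDiff 𝓘(ℝ, X.𝔥) 𝓘(ℝ, V) ∞ lam₀ ∧ ContMDiff 𝓘(ℝ, X.𝔤) 𝓘(ℝ, W) ∞ lam₁ ∧
      lam₀ 1 = 0 ∧ lam₁ 1 = 0 ∧ IsCobounded ρ τ τ' lam₀ lam₁ := by
  constructor
  · rintro ⟨⟨lam₀, lam₁, v⟩, ⟨s₀, s₁, n₀, n₁⟩, h⟩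
    simp only [nabla₁, LinearMap.coe_mk, AddHom.coe_mk, toCochain, Prod.ext_iff,
      Prod.fst_sub, Prod.snd_sub, funext_iff, Pi.sub_apply, sub_self,
      Prod.fst_zero, Prod.snd_zero, Pi.zero_apply, neg_eq_zero] at h
    obtain ⟨e₀, eα, eχ, e₁, -, rfl⟩ := h
    change lam₀ 1 = 0 at n₀
    refine ⟨lam₀, lam₁, s₀, s₁, n₀, n₁, fun a b => ?_, fun a b => ?_, fun h g => ?_, fun g => ?_⟩
    · linear_combination (norm := abel) -(e₀ a b)
    · linear_combination (norm := abel) -(e₁ a b)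
    · rw [map_add]
      linear_combination (norm := abel) -(eα h g)
    · have e := eχ g 1
      -- The tuples are not assumed normalised here; this shows that their values ω₀(1, i g) agree
      -- and cancel.
      have e' := e₀ 1 (X.i g)
      simp only [one_mul, map_one, one_apply_eq_self, n₀, map_zero] at e e'
      linear_combination (norm := abel) e' - e
  · rintro ⟨lam₀, lam₁, s₀, s₁, n₀, n₁, e₀, e₁, eα, eχ⟩
    refine ⟨(lam₀, lam₁, 0), ⟨s₀, s₁, n₀, n₁⟩, ?_⟩
    simp only [nabla₁, LinearMap.coe_mk, AddHom.coe_mk, toCochain, Prod.ext_iff,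
      Prod.fst_sub, Prod.snd_sub, funext_iff, Pi.sub_apply, sub_self,
      Prod.fst_zero, Prod.snd_zero, Pi.zero_apply, neg_eq_zero]
    refine ⟨fun a b => ?_, fun h g => ?_, fun g h => ?_, fun a b => ?_, fun g => ?_, trivial⟩
    · linear_combination (norm := abel) -(e₀ a b)
    · have e := eα h g
      rw [map_add] at e
      linear_combination (norm := abel) -e
    · have e := congrArg (ρ.ρV h) (eχ g)
      have e' := e₀ h (X.i g)
      simp only [map_add, map_zero] at e ⊢
      linear_combination (norm := abel) -e - e'
    · linear_combination (norm := abel) -(e₁ a b)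
    · simp

/-- An equivalence preserves base points, so on the zero section it is given by functions lam₀,
lam₁. Compatibility with both products, the action and the structural map, read on the zero section,
gives the four conditions. -/
theorem Defines.exists_isCobounded (h : τ.Defines ρ E) (h' : τ'.Defines ρ E')
    (hE : E.IsEquivalent E') :
    ∃ lam₀ lam₁, ContMDiff 𝓘(ℝ, X.𝔥) 𝓘(ℝ, V) ∞ lam₀ ∧ ContMDiff 𝓘(ℝ, X.𝔤) 𝓘(ℝ, W) ∞ lam₁ ∧
      lam₀ 1 = 0 ∧ lam₁ 1 = 0 ∧ IsCobounded ρ τ τ' lam₀ lam₁ := by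
  have d := h.isExtensionData
  have d' := h'.isExtensionData
  obtain ⟨Θ₁, Θ₀, m₀, m₁, hi, ha, hj₁, hj₀, hπ₁, hπ₀⟩ := h
  obtain ⟨Θ₁', Θ₀', m₀', m₁', hi', ha', hj₁', hj₀', hπ₁', hπ₀'⟩ := h'
  obtain ⟨ψ₁, ψ₀, ⟨s₁, -⟩, ⟨s₀, -⟩, ψi, ψa, ψj₁, ψj₀, ψπ₁, ψπ₀⟩ := hE
  have inj₀ {a b : X.H} {u v : V} (h : Θ₀' (a, u) = Θ₀' (b, v)) : u = v :=
    (Prod.ext_iff.1 (Θ₀'.injective h)).2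
  have inj₁ {a b : X.G} {u v : W} (h : Θ₁' (a, u) = Θ₁' (b, v)) : u = v :=
    (Prod.ext_iff.1 (Θ₁'.injective h)).2
  let lam₀ : X.H → V := fun h => (Θ₀'.symm (ψ₀ (Θ₀ (h, 0)))).2
  let lam₁ : X.G → W := fun g => (Θ₁'.symm (ψ₁ (Θ₁ (g, 0)))).2
  have q₀ (h : X.H) : ψ₀ (Θ₀ (h, 0)) = Θ₀' (h, lam₀ h) := by
    obtain ⟨a, u, hp⟩ := Θ₀'.exists_mk_eq (ψ₀ (Θ₀ (h, 0)))
    have e := hπ₀' a u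
    rw [hp, ψπ₀, hπ₀] at e
    have e' : lam₀ h = u := by simp only [lam₀, ← hp, Diffeomorph.symm_apply_apply]
    rw [e', ← hp, e]
  have q₁ (g : X.G) : ψ₁ (Θ₁ (g, 0)) = Θ₁' (g, lam₁ g) := by
    obtain ⟨a, u, hp⟩ := Θ₁'.exists_mk_eq (ψ₁ (Θ₁ (g, 0)))
    have e := hπ₁' a u
    rw [hp, ψπ₁, hπ₁] at e
    have e' : lam₁ g = u := by simp only [lam₁, ← hp, Diffeomorph.symm_apply_apply]
    rw [e', ← hp, e]
  -- Since (h, v) = (1, v)(h, 0) and the equivalence fixes V, its values on the zero section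
  -- determine it as a shear.
  have p₀ (h : X.H) (v : V) : ψ₀ (Θ₀ (h, v)) = Θ₀' (h, v + lam₀ h) := by
    have e : Θ₀ (h, v) = E.j₀ v * Θ₀ (h, 0) := by
      rw [hj₀, m₀]
      simp [d.ω₀_one_left]
    rw [e, map_mul, ψj₀, hj₀', q₀, m₀']
    simp [d'.ω₀_one_left]
  have p₁ (g : X.G) (w : W) : ψ₁ (Θ₁ (g, w)) = Θ₁' (g, w + lam₁ g) := by
    have e : Θ₁ (g, w) = E.j₁ w * Θ₁ (g, 0) := by
      rw [hj₁, m₁]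
      simp [d.ω₁_one_left]
    rw [e, map_mul, ψj₁, hj₁', q₁, m₁']
    simp [d'.ω₁_one_left]
  refine ⟨lam₀, lam₁, ?_, ?_, ?_, ?_, fun a b => ?_, fun a b => ?_, fun h g => ?_, fun g => ?_⟩
  · exact contMDiff_snd.comp (Θ₀'.symm.contMDiff.comp (s₀.comp (Θ₀.contMDiff.comp
      (contMDiff_id.prodMk contMDiff_const))))
  · exact contMDiff_snd.comp (Θ₁'.symm.contMDiff.comp (s₁.comp (Θ₁.contMDiff.comp
      (contMDiff_id.prodMk contMDiff_const))))
  · have e := q₀ 1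
    rw [← hj₀, ψj₀, hj₀'] at e
    exact (inj₀ e).symm
  · have e := q₁ 1
    rw [← hj₁, ψj₁, hj₁'] at e
    exact (inj₁ e).symm
  · have e := ψ₀.map_mul (Θ₀ (a, 0)) (Θ₀ (b, 0))
    rw [m₀, p₀, p₀, p₀, m₀'] at e
    have e := inj₀ e
    simp only [map_zero, zero_add] at e
    linear_combination (norm := abel) e
  · have e := ψ₁.map_mul (Θ₁ (a, 0)) (Θ₁ (b, 0))
    rw [m₁, p₁, p₁, p₁, m₁'] at e
    have e := inj₁ e
    simp only [map_zero, zero_add] at e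
    linear_combination (norm := abel) e
  · have e := ψa (Θ₁ (g, 0)) (Θ₀ (h, 0))
    rw [ha, p₁, p₁, p₀, ha'] at e
    have e := inj₁ e
    simp only [map_zero, zero_add] at e
    linear_combination (norm := abel) e
  · have e := ψi (Θ₁ (g, 0))
    rw [hi, p₁, p₀, hi'] at e
    have e := inj₀ e
    simp only [map_zero, zero_add] at e
    linear_combination (norm := abel) -e

/-- The shear `(x, u) ↦ (x, u + lam x)` of a product. -/
def shear {𝔨 K U : Type*} [NormedAddCommGroup 𝔨] [NormedSpace ℝ 𝔨] [TopologicalSpace K]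
    [ChartedSpace 𝔨 K] [NormedAddCommGroup U] [NormedSpace ℝ U] (lam : K → U)
    (hlam : ContMDiff 𝓘(ℝ, 𝔨) 𝓘(ℝ, U) ∞ lam) :
    Diffeomorph (𝓘(ℝ, 𝔨).prod 𝓘(ℝ, U)) (𝓘(ℝ, 𝔨).prod 𝓘(ℝ, U)) (K × U) (K × U) ∞ where
  toFun p := (p.1, p.2 + lam p.1)
  invFun p := (p.1, p.2 - lam p.1)
  left_inv p := by simp
  right_inv p := by simp
  contMDiff_toFun := contMDiff_fst.prodMk (contMDiff_snd.add (hlam.comp contMDiff_fst))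
  contMDiff_invFun := contMDiff_fst.prodMk (contMDiff_snd.sub (hlam.comp contMDiff_fst))

/-- The equivalence is the shear read through the two trivialisations; lam₀ 1 = 0 and lam₁ 1 = 0
make it compatible with the inclusions. -/
theorem Defines.isEquivalent (h : τ.Defines ρ E) (h' : τ'.Defines ρ E') {lam₀ : X.H → V}
    {lam₁ : X.G → W} (s₀ : ContMDiff 𝓘(ℝ, X.𝔥) 𝓘(ℝ, V) ∞ lam₀)
    (s₁ : ContMDiff 𝓘(ℝ, X.𝔤) 𝓘(ℝ, W) ∞ lam₁) (n₀ : lam₀ 1 = 0) (n₁ : lam₁ 1 = 0)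
    (b : IsCobounded ρ τ τ' lam₀ lam₁) : E.IsEquivalent E' := by
  obtain ⟨Θ₁, Θ₀, m₀, m₁, hi, ha, hj₁, hj₀, hπ₁, hπ₀⟩ := h
  obtain ⟨Θ₁', Θ₀', m₀', m₁', hi', ha', hj₁', hj₀', hπ₁', hπ₀'⟩ := h'
  let ψ₀ := (Θ₀.symm.trans (shear lam₀ s₀)).trans Θ₀'
  let ψ₁ := (Θ₁.symm.trans (shear lam₁ s₁)).trans Θ₁'
  have p₀ (h : X.H) (v : V) : ψ₀ (Θ₀ (h, v)) = Θ₀' (h, v + lam₀ h) := by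
    change Θ₀' (shear lam₀ s₀ (Θ₀.symm (Θ₀ (h, v)))) = _
    rw [Diffeomorph.symm_apply_apply]
    rfl
  have p₁ (g : X.G) (w : W) : ψ₁ (Θ₁ (g, w)) = Θ₁' (g, w + lam₁ g) := by
    change Θ₁' (shear lam₁ s₁ (Θ₁.symm (Θ₁ (g, w)))) = _
    rw [Diffeomorph.symm_apply_apply]
    rfl
  refine ⟨{ ψ₁.toEquiv with map_mul' := fun e f => ?_ },
    { ψ₀.toEquiv with map_mul' := fun x y => ?_ },
    ⟨ψ₁.contMDiff, ψ₁.symm.contMDiff⟩, ⟨ψ₀.contMDiff, ψ₀.symm.contMDiff⟩,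
    fun e => ?_, fun e x => ?_, fun w => ?_, fun v => ?_, fun e => ?_, fun x => ?_⟩
  · change ψ₁ (e * f) = ψ₁ e * ψ₁ f
    obtain ⟨a, u, rfl⟩ := Θ₁.exists_mk_eq e
    obtain ⟨c, v, rfl⟩ := Θ₁.exists_mk_eq f
    rw [m₁, p₁, p₁, p₁, m₁']
    congr 2
    rw [map_add]
    linear_combination (norm := abel) b.ω₁_add a c
  · change ψ₀ (x * y) = ψ₀ x * ψ₀ y
    obtain ⟨a, u, rfl⟩ := Θ₀.exists_mk_eq x
    obtain ⟨c, v, rfl⟩ := Θ₀.exists_mk_eq y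
    rw [m₀, p₀, p₀, p₀, m₀']
    congr 2
    rw [map_add]
    linear_combination (norm := abel) b.ω₀_add a c
  · change E'.E.i (ψ₁ e) = ψ₀ (E.E.i e)
    obtain ⟨g, w, rfl⟩ := Θ₁.exists_mk_eq e
    rw [hi, p₁, p₀, hi']
    congr 2
    rw [map_add]
    linear_combination (norm := abel) -(b.χ_add g)
  · change ψ₁ (E.E.act e x) = E'.E.act (ψ₁ e) (ψ₀ x)
    obtain ⟨g, w, rfl⟩ := Θ₁.exists_mk_eq e
    obtain ⟨h, v, rfl⟩ := Θ₀.exists_mk_eq x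
    rw [ha, p₁, p₁, p₀, ha']
    congr 2
    have e := b.α_add h g
    simp only [map_add] at e ⊢
    linear_combination (norm := abel) e
  · change ψ₁ (E.j₁ w) = _
    rw [hj₁, p₁, hj₁', n₁, add_zero]
  · change ψ₀ (E.j₀ v) = _
    rw [hj₀, p₀, hj₀', n₀, add_zero]
  · change E'.π₁ (ψ₁ e) = _
    obtain ⟨g, w, rfl⟩ := Θ₁.exists_mk_eq e
    rw [p₁, hπ₁, hπ₁']
  · change E'.π₀ (ψ₀ x) = _
    obtain ⟨h, v, rfl⟩ := Θ₀.exists_mk_eq x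
    rw [p₀, hπ₀, hπ₀']

theorem Defines.isEquivalent_iff (h : τ.Defines ρ E) (h' : τ'.Defines ρ E') :
    E.IsEquivalent E' ↔ τ.toCochain ρ - τ'.toCochain ρ ∈ coboundaries₂ ρ := by
  rw [sub_mem_coboundaries₂_iff]
  refine ⟨h.exists_isCobounded h', ?_⟩
  rintro ⟨lam₀, lam₁, s₀, s₁, n₀, n₁, b⟩
  exact h.isEquivalent h' s₀ s₁ n₀ n₁ b

end FourTuple

/-! ### The bijection with second cohomology. -/

section Classification

variable {X : LieTwoGroup.{u}} {W V : Type u}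
  [NormedAddCommGroup W] [NormedSpace ℝ W] [FiniteDimensional ℝ W]
  [NormedAddCommGroup V] [NormedSpace ℝ V] [FiniteDimensional ℝ V]
  {φ : W →L[ℝ] V}

theorem exists_equiv_extensionClass (ρ : TwoRep X φ) : ∃ Φ : H₂ ρ ≃ ExtensionClass ρ,
    ∀ (τ : FourTuple X W V) (hτ : τ.toCochain ρ ∈ cocycles₂ ρ) (E : SplitExtension ρ),
      τ.Defines ρ E.1 → Φ (Submodule.Quotient.mk ⟨τ.toCochain ρ, hτ⟩) = ⟦E⟧ := by
  have hex (c : cocycles₂ ρ) : ∃ (E : SplitExtension ρ) (τ : FourTuple X W V),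
      τ.Defines ρ E.1 ∧ (c : PreCochain₂ X W V) - τ.toCochain ρ ∈ coboundaries₂ ρ := by
    obtain ⟨τ, hτ, h⟩ := FourTuple.exists_toCochain_cohomologous c.2
    obtain ⟨E, hE⟩ := FourTuple.exists_defines_iff.2 hτ
    exact ⟨⟨E, hE.exists_induces⟩, τ, hE, h⟩
  choose E τ hE hτ using hex
  -- The chosen extension of c is compared with an arbitrary defined extension. Independence of
  -- representatives, injectivity, surjectivity and the prescribed values of the bijection all
  -- reduce to this.
  have key (c : cocycles₂ ρ) (τ' : FourTuple X W V) (E' : SplitExtension ρ)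
      (h' : τ'.Defines ρ E'.1) :
      (⟦E c⟧ : ExtensionClass ρ) = ⟦E'⟧ ↔
        (c : PreCochain₂ X W V) - τ'.toCochain ρ ∈ coboundaries₂ ρ := by
    rw [Quotient.eq, ← sub_add_sub_cancel (c : PreCochain₂ X W V) ((τ c).toCochain ρ),
      Submodule.add_mem_iff_right _ (hτ c)]
    exact (hE c).isEquivalent_iff h'
  have hwd (c c' : cocycles₂ ρ) :
      (⟦E c⟧ : ExtensionClass ρ) = ⟦E c'⟧ ↔
        (Submodule.Quotient.mk c : H₂ ρ) = Submodule.Quotient.mk c' := by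
    rw [key c _ _ (hE c'), Submodule.Quotient.eq,
      ← sub_add_sub_cancel (c : PreCochain₂ X W V) c', Submodule.add_mem_iff_left _ (hτ c')]
    rfl
  let F : H₂ ρ → ExtensionClass ρ := fun q => ⟦E (Quotient.out q)⟧
  have hF (c : cocycles₂ ρ) : F (Submodule.Quotient.mk c) = ⟦E c⟧ :=
    (hwd _ _).2 (Quotient.out_eq _)
  refine ⟨Equiv.ofBijective F ⟨fun p q h => ?_, fun q => ?_⟩, fun τ' h' E' hd => ?_⟩
  · obtain ⟨c, rfl⟩ := Submodule.Quotient.mk_surjective _ p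
    obtain ⟨c', rfl⟩ := Submodule.Quotient.mk_surjective _ q
    rw [hF, hF] at h
    exact (hwd c c').1 h
  · induction q using Quotient.inductionOn with | _ E' =>
    obtain ⟨τ', hd⟩ := Extension.exists_defines E'.2
    refine ⟨Submodule.Quotient.mk ⟨τ'.toCochain ρ, FourTuple.exists_defines_iff.1 ⟨_, hd⟩⟩, ?_⟩
    rw [hF, key _ τ' E' hd, sub_self]
    exact zero_mem _
  · change F _ = _
    rw [hF, key _ τ' E' hd, sub_self]
    exact zero_mem _

end Classification

theorem mainTheorem1 (X : LieTwoGroup.{u}) {W V : Type u}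
    [NormedAddCommGroup W] [NormedSpace ℝ W] [FiniteDimensional ℝ W]
    [NormedAddCommGroup V] [NormedSpace ℝ V] [FiniteDimensional ℝ V] (φ : W →L[ℝ] V) :
    -- a split extension induces exactly one 2-representation, whatever the splitting
    (∀ E : Extension X φ, Nonempty E.Splitting →
      ∃! ρ : TwoRep X φ, ∀ σ : E.Splitting, σ.Induces ρ) ∧
    -- equivalent extensions are simultaneously split, and induce the same 2-representations
    (∀ E F : Extension X φ, E.IsEquivalent F → ∀ ρ : TwoRep X φ,
      (∃ σ : E.Splitting, σ.Induces ρ) → ∃ σ : F.Splitting, σ.Induces ρ) ∧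
    ∀ ρ : TwoRep X φ,
      -- a 4-tuple defines an extension if and only if the associated 2-cochain is a cocycle
      (∀ τ : FourTuple X W V, (∃ E : Extension X φ, τ.Defines ρ E) ↔
        τ.toCochain ρ ∈ cocycles₂ ρ) ∧
      -- the extensions so defined are the split extensions inducing `ρ`
      (∀ E : Extension X φ, (∃ τ : FourTuple X W V, τ.Defines ρ E) ↔
        ∃ σ : E.Splitting, σ.Induces ρ) ∧
      -- the cocycles `(ω₀, α, χ, ω₁, lam, v)` with `v = 0` are the cocycles given by 4-tuples,
      (∀ c ∈ cocycles₂ ρ, c.2.2.2.2.2 = 0 → ∃! τ : FourTuple X W V, τ.toCochain ρ = c) ∧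
      -- and every cocycle is cohomologous to one of them
      (∀ c ∈ cocycles₂ ρ, ∃ τ : FourTuple X W V, τ.toCochain ρ ∈ cocycles₂ ρ ∧
        c - τ.toCochain ρ ∈ coboundaries₂ ρ) ∧
      -- 4-tuples define equivalent extensions if and only if their cocycles are cohomologous
      (∀ (τ τ' : FourTuple X W V) (E E' : Extension X φ), τ.Defines ρ E → τ'.Defines ρ E' →
        (E.IsEquivalent E' ↔ τ.toCochain ρ - τ'.toCochain ρ ∈ coboundaries₂ ρ)) ∧
      -- hence the second cohomology is in bijection with the equivalence classes of extensions
      ∃ Φ : H₂ ρ ≃ ExtensionClass ρ,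
        ∀ (τ : FourTuple X W V) (hτ : τ.toCochain ρ ∈ cocycles₂ ρ) (E : SplitExtension ρ),
          τ.Defines ρ E.1 → Φ (Submodule.Quotient.mk ⟨τ.toCochain ρ, hτ⟩) = ⟦E⟧ := by
  refine ⟨fun E hE => Extension.existsUnique_induces hE, fun E F h ρ hE => h.exists_induces hE,
    fun ρ => ⟨fun τ => FourTuple.exists_defines_iff, fun E => ⟨?_, Extension.exists_defines⟩,
      fun c hc hv => FourTuple.existsUnique_toCochain_eq hc hv,
      fun c hc => FourTuple.exists_toCochain_cohomologous hc,
      fun τ τ' E E' h h' => h.isEquivalent_iff h', exists_equiv_extensionClass ρ⟩⟩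
  rintro ⟨τ, h⟩
  exact h.exists_induces
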